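/- Let $\mathbf T$ be the unit circle, $\alpha$ its Haar probability measure, and for $f:\mathbf T\to\mathbb R$ write $f'(z)=\frac{d}{dt}\big|_{t=0}f(ze^{it})$. For a continuous $Q:\mathbf T\to\mathbb R$ and a probability measure $\mu$ on $\mathbf T$ let $$E_Q(\mu)=\int Q\,d\mu-\iint\log|z-w|\,\mu(dz)\,\mu(dw)\in(-\infty,+\infty],$$ and let $\mu_Q$ be the equilibrium measure, i.e. the minimizer of $E_Q$ over all probability measures on $\mathbf T$. Let $$H\mu(e^{ix})=\mathrm{p.v.}\int\cot\Big(\frac{x-y}{2}\Big)\,\mu(de^{iy}),\qquad I_Q(\mu)=\int(H\mu-Q')^2\,d\mu-\Big(\int Q'\,d\mu\Big)^2 .$$ For $u\in\mathbb R$ let $\bar\mu_u$ be the lift of $\mu$ to $[u,u+2\pi)$, i.e. the image of $\mu$ under the inverse of $x\mapsto e^{ix}$, $[u,u+2\pi)\to\mathbf T$. With $W_2$ the usual Wasserstein distance on $\mathbb R$, let $$\mathcal W_2(\mu,\nu)=\sup\Big\{W_2(\bar\mu_u,\bar\nu_v):\ u,v\in[0,2\pi],\ \int x\,\bar\mu_u(dx)=\int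 x\,\bar\nu_v(dx)\Big\},\qquad \sup\emptyset=+\infty .$$ **Theorem.** Let $Q:\mathbf T\to\mathbb R$ be of class $C^3$ with $Q''\ge\rho-\frac12$ on $\mathbf T$ for some $\rho\in\mathbb R$. Then $Q$ satisfies the free inequality $HWI(\rho/2)$: for every smooth probability measure $\mu$ on $\mathbf T$ (that is, $d\mu=\varphi\,d\alpha$ with $\varphi\ge0$ of class $C^\infty$), the principal value $H\mu(z)$ exists for every $z\in\mathbf T$, $(H\mu-Q')^2$ is $\mu$-integrable, $I_Q(\mu)\ge0$, the quantities $E_Q(\mu)$, $E_Q(\mu_Q)$ and $\mathcal W_2(\mu,\mu_Q)$ are finite, and $$E_Q(\mu)-E_Q(\mu_Q)\le\sqrt{I_Q(\mu)}\;\mathcal W_2(\mu,\mu_Q)-\frac{\rho}{2}\,\mathcal W_2(\mu,\mu_Q)^2 .$$ -/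

import Mathlib

open MeasureTheory Filter Topology Set
open scoped ENNReal ContDiff

namespace FreeCircle

noncomputable section

/-- The unit circle `𝐓` with its Borel σ-algebra. -/
instance instMeasurableSpaceCircle : MeasurableSpace Circle := borel Circle

instance instBorelSpaceCircle : BorelSpace Circle := ⟨rfl⟩

/-! ### Functions on the circle -/

/-- `f : 𝐓 → ℝ` is of class `C^n` when `x ↦ f (e^{ix})` is of class `C^n` on the real line. -/
def IsCn (n : WithTop ℕ∞) (f : Circle → ℝ) : Prop :=
  ContDiff ℝ n fun x : ℝ => f (Circle.exp x)

/-- The derivative `f'(z) = d/dt f(z e^{it})` at `t = 0`. -/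
def circleDeriv (f : Circle → ℝ) (z : Circle) : ℝ :=
  deriv (fun t : ℝ => f (z * Circle.exp t)) 0

/-- The Haar probability measure `α`:
`∫ f dα = (1 / 2π) ∫_{-π}^{π} f(e^{ix}) dx`. -/
def haar : Measure Circle :=
  ENNReal.ofReal (1 / (2 * Real.pi)) •
    (volume.restrict (Ioc (-Real.pi) Real.pi)).map Circle.exp

/-- A smooth measure: one of the form `φ dα` with a nonnegative `C^∞` density `φ`. -/
def IsSmoothMeasure (μ : Measure Circle) : Prop :=
  ∃ φ : Circle → ℝ, IsCn ∞ φ ∧ (∀ z, 0 ≤ φ z) ∧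
    μ = haar.withDensity fun z => ENNReal.ofReal (φ z)

/-! ### Logarithmic energy and equilibrium measure -/

/-- The logarithmic energy `E_Q(μ) = ∫ Q dμ - ∬ log |z - w| μ(dz) μ(dw)`, with values in the
extended reals. Here `log 0 = -∞`, and the double integral is the integral of the positive part
(at most `log 2` on a probability measure) minus the integral of the negative part. -/
def energy (Q : Circle → ℝ) (μ : Measure Circle) : EReal :=
  ((∫ z, Q z ∂μ : ℝ) : EReal)
    + ((∫⁻ z : Circle, ∫⁻ w : Circle,
          (-ENNReal.log ‖(z : ℂ) - (w : ℂ)‖ₑ).toENNReal ∂μ ∂μ : ℝ≥0∞) : EReal)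
    - ((∫⁻ z : Circle, ∫⁻ w : Circle,
          (ENNReal.log ‖(z : ℂ) - (w : ℂ)‖ₑ).toENNReal ∂μ ∂μ : ℝ≥0∞) : EReal)

/-- `μ` is the equilibrium measure `μ_Q`: a probability measure minimizing `E_Q` among all
probability measures on the circle. -/
def IsEquilibriumMeasure (Q : Circle → ℝ) (μ : Measure Circle) : Prop :=
  IsProbabilityMeasure μ ∧
    ∀ ν : Measure Circle, IsProbabilityMeasure ν → energy Q μ ≤ energy Q ν

/-! ### Hilbert transform and free Fisher information -/

/-- The integral of `cot ((x - y) / 2)`, where `z = e^{ix}` and `w = e^{iy}`, over the points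
`w` with `|z - w| > ε`. -/
def hilbertTrunc (μ : Measure Circle) (z : Circle) (ε : ℝ) : ℝ :=
  ∫ w in {w : Circle | ε < ‖(z : ℂ) - (w : ℂ)‖}, Real.cot (Complex.arg ((z : ℂ) / w) / 2) ∂μ

/-- The Hilbert transform `Hμ(z) = p.v. ∫ cot ((x - y) / 2) μ(dw)`, `z = e^{ix}`, `w = e^{iy}`. -/
def hilbert (μ : Measure Circle) (z : Circle) : ℝ :=
  limUnder (𝓝[>] (0 : ℝ)) (hilbertTrunc μ z)

/-- `I_Q(μ) = ∫ (Hμ - Q')² dμ - (∫ Q' dμ)²`. -/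
def fisherInfo (Q : Circle → ℝ) (μ : Measure Circle) : ℝ :=
  ∫ z, (hilbert μ z - circleDeriv Q z) ^ 2 ∂μ - (∫ z, circleDeriv Q z ∂μ) ^ 2

/-! ### The modified Wasserstein distance -/

/-- The Wasserstein distance `W_p` on the real line, as an infimum over couplings. -/
def wasserstein (p : ℝ) (μ ν : Measure ℝ) : ℝ≥0∞ :=
  (⨅ (γ : Measure (ℝ × ℝ)) (_ : γ.map Prod.fst = μ ∧ γ.map Prod.snd = ν),
    ∫⁻ q, ‖q.1 - q.2‖ₑ ^ p ∂γ) ^ (1 / p)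

/-- The inverse `𝐓 → [u, u + 2π)` of the restriction of `x ↦ e^{ix}` to `[u, u + 2π)`. -/
def liftAngle (u : ℝ) (z : Circle) : ℝ :=
  toIcoMod Real.two_pi_pos u (Complex.arg z)

theorem liftAngle_mem (u : ℝ) (z : Circle) : liftAngle u z ∈ Ico u (u + 2 * Real.pi) :=
  toIcoMod_mem_Ico _ _ _

theorem exp_liftAngle (u : ℝ) (z : Circle) : Circle.exp (liftAngle u z) = z := by
  unfold liftAngle toIcoMod
  rw [zsmul_eq_mul, Circle.periodic_exp.sub_int_mul_eq, Circle.exp_arg]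

theorem measurable_liftAngle (u : ℝ) : Measurable (liftAngle u) := by
  have h1 : Measurable fun z : Circle => Complex.arg (z : ℂ) :=
    Complex.measurable_arg.comp (show Continuous fun z : Circle => (z : ℂ) by fun_prop).measurable
  have h2 : liftAngle u = fun z : Circle =>
      u + Int.fract ((Complex.arg (z : ℂ) - u) / (2 * Real.pi)) * (2 * Real.pi) := by
    funext z
    simp only [liftAngle, toIcoMod_eq_add_fract_mul]
  rw [h2]
  exact ((measurable_fract.comp ((h1.sub_const u).div_const _)).mul_const _).const_add u

/-- The lift `μ̄_u` of `μ` to the interval `[u, u + 2π)`. -/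
def lift (μ : Measure Circle) (u : ℝ) : Measure ℝ :=
  μ.map (liftAngle u)

/-- The base points `u, v ∈ [0, 2π]` for which the lifts of `μ` and `ν` have the same mean. -/
def SameMean (μ ν : Measure Circle) (u v : ℝ) : Prop :=
  u ∈ Icc 0 (2 * Real.pi) ∧ v ∈ Icc 0 (2 * Real.pi) ∧
    ∫ x, x ∂(lift μ u) = ∫ x, x ∂(lift ν v)

open Classical in
/-- The modified Wasserstein distance `𝒲_p`: the supremum of `W_p(μ̄_u, ν̄_v)` over all `u, v` for
which the lifts have the same mean, with the convention that the supremum of the empty set is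
`+∞`. -/
def modWasserstein (p : ℝ) (μ ν : Measure Circle) : ℝ≥0∞ :=
  if ∃ u v, SameMean μ ν u v then
    ⨆ (u : ℝ) (v : ℝ) (_ : SameMean μ ν u v), wasserstein p (lift μ u) (lift ν v)
  else ⊤

/-! ### The free HWI inequality -/

/-- All quantities in the free HWI inequality for `μ` and `μQ` are well defined and finite: the
principal values `Hμ(z)` exist, `(Hμ - Q')²` is integrable, `I_Q(μ)` is nonnegative, and the
energies and the modified Wasserstein distance are finite. -/
def HWIWellDefined (Q : Circle → ℝ) (μ μQ : Measure Circle) : Prop :=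
  (∀ z, Tendsto (hilbertTrunc μ z) (𝓝[>] 0) (𝓝 (hilbert μ z))) ∧
  Integrable (fun z => (hilbert μ z - circleDeriv Q z) ^ 2) μ ∧
  0 ≤ fisherInfo Q μ ∧
  energy Q μ ≠ ⊤ ∧ energy Q μQ ≠ ⊤ ∧
  modWasserstein 2 μ μQ ≠ ⊤

/-- The free inequality `HWI(c)` for the potential `Q`: for every smooth probability measure `μ`,
`E_Q(μ) - E_Q(μ_Q) ≤ √(I_Q(μ)) 𝒲₂(μ, μ_Q) - c 𝒲₂(μ, μ_Q)²`, where all terms are finite. -/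
def FreeHWI (Q : Circle → ℝ) (c : ℝ) : Prop :=
  ∀ μ : Measure Circle, IsProbabilityMeasure μ → IsSmoothMeasure μ →
    ∀ μQ : Measure Circle, IsEquilibriumMeasure Q μQ →
      HWIWellDefined Q μ μQ ∧
      energy Q μ - energy Q μQ ≤
        ((Real.sqrt (fisherInfo Q μ) * (modWasserstein 2 μ μQ).toReal
          - c * (modWasserstein 2 μ μQ).toReal ^ 2 : ℝ) : EReal)

end

end FreeCircle

namespace FreeCircle

noncomputable section

/-! Write `ν` for the equilibrium measure. Fix base points `u`, `v` whose lifts have equal mean, let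
`T` be the monotone map carrying `lift μ u` to `lift ν v`, and set `X = liftAngle u`, `Y = T ∘ X`,
`h = Y - X`. Monotonicity keeps the order of any two points, so their angle difference stays in `[0,
2π]`, where `-log (2 sin (θ/2))` has second derivative `1 / (4 sin² (θ/2)) ≥ 1/4`. The tangent
inequality for pairs of points (`log_chord_tangent`), integrated over `μ × μ`, shows that transport
changes the logarithmic energy by at least `-∫ Hμ h + (1/8) ∬ (h z - h w)²`. Equal means say `∫ h dμ
= 0`, so the double integral is `2 ∫ h²` and the gain is `(1/4) ∫ h²`. The potential changes by at
least `∫ Q' h + ((ρ - 1/2)/2) ∫ h²`. The constants add up to `ρ/2`, and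
`HilbertBounded.energy_displacement` gives `E(μ) - E(ν) ≤ ∫ (Hμ - Q') h dμ - (ρ/2) ∫ h²`.

Because `∫ h dμ = 0`, the constant `∫ Q' dμ` may be added to `Hμ - Q'`. This centres it, as `∫ Hμ dμ
= 0` by oddness of the kernel, and its squared `L²(μ)` norm becomes `I_Q(μ)`. Cauchy–Schwarz and the
optimality of monotone transport (`wasserstein_two_eq`) then give the inequality with `w = W₂` of
the two lifts (`HilbertBounded.hwi_of_sameMean`). It is a closed condition on `w`, so it passes to
the supremum `𝒲₂`.

The analytic input is that a `C¹` density gives truncated Hilbert transforms bounded uniformly in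
the point and the cutoff, which justifies the limits. -/

/-! ### Tangent inequalities from second derivative bounds -/

theorem second_order_lower_bound {s : Set ℝ} (hs : Convex ℝ s) (hso : IsOpen s) {f f' f'' : ℝ → ℝ}
    (hf : ∀ x ∈ s, HasDerivAt f (f' x) x) (hf' : ∀ x ∈ s, HasDerivAt f' (f'' x) x) {c : ℝ}
    (hc : ∀ x ∈ s, c ≤ f'' x) {a b : ℝ} (ha : a ∈ s) (hb : b ∈ s) :
    f a + f' a * (b - a) + c / 2 * (b - a) ^ 2 ≤ f b := by
  have hg : ∀ x ∈ s, HasDerivAt (fun x => f x - c / 2 * (x - a) ^ 2) (f' x - c * (x - a)) x := by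
    intro x hx
    have := (hf x hx).sub ((((hasDerivAt_id x).sub_const a).pow 2).const_mul (c / 2))
    refine this.congr_deriv ?_
    simp; ring
  have hg' : ∀ x ∈ s, HasDerivAt (fun x => f' x - c * (x - a)) (f'' x - c) x := by
    intro x hx
    have := (hf' x hx).sub (((hasDerivAt_id x).sub_const a).const_mul c)
    refine this.congr_deriv ?_
    simp
  -- Removing the quadratic leaves a convex function, and its tangent line at `a` is the claim.
  have hconv : ConvexOn ℝ s (fun x => f x - c / 2 * (x - a) ^ 2) := by
    refine convexOn_of_hasDerivWithinAt2_nonneg hs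
      (fun x hx => (hg x hx).continuousAt.continuousWithinAt)
      (f' := fun x => f' x - c * (x - a)) (f'' := fun x => f'' x - c) ?_ ?_ ?_
    all_goals rw [hso.interior_eq]
    · exact fun x hx => (hg x hx).hasDerivWithinAt
    · exact fun x hx => (hg' x hx).hasDerivWithinAt
    · exact fun x hx => sub_nonneg.2 (hc x hx)
  have hga := hg a ha
  simp only [sub_self, mul_zero, sub_zero] at hga
  rcases lt_trichotomy a b with hab | rfl | hab
  · have := hconv.le_slope_of_hasDerivAt ha hb hab hga
    rw [slope_def_field, le_div_iff₀ (sub_pos.2 hab)] at this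
    simp only [sub_self] at this
    nlinarith
  · simp
  · have := hconv.slope_le_of_hasDerivAt hb ha hab hga
    rw [slope_def_field, div_le_iff₀ (sub_pos.2 hab)] at this
    simp only [sub_self] at this
    nlinarith

/-- The tangent inequality for `-log (2 sin (θ / 2))`, whose second derivative is at least `1 / 4`. -/
theorem log_sin_tangent {θ θ' : ℝ} (h : θ ∈ Ioo 0 (2 * Real.pi)) (h' : θ' ∈ Ioo 0 (2 * Real.pi)) :
    -(1 / 2) * Real.cot (θ / 2) * (θ' - θ) + 1 / 8 * (θ' - θ) ^ 2 ≤
      Real.log (2 * Real.sin (θ / 2)) - Real.log (2 * Real.sin (θ' / 2)) := by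
  have hpos : ∀ x ∈ Ioo 0 (2 * Real.pi), 0 < Real.sin (x / 2) := fun x hx =>
    Real.sin_pos_of_pos_of_lt_pi (by linarith [hx.1]) (by linarith [hx.2])
  have key := second_order_lower_bound (convex_Ioo 0 (2 * Real.pi)) isOpen_Ioo
    (f := fun x => -Real.log (2 * Real.sin (x / 2))) (f' := fun x => -(1 / 2) * Real.cot (x / 2))
    (f'' := fun x => 1 / (4 * Real.sin (x / 2) ^ 2)) (c := 1 / 4) ?_ ?_ ?_ h h'
  · linarith
  · intro x hx
    have hs := (hpos x hx).ne'
    have h1 := ((((hasDerivAt_id x).div_const 2).sin.const_mul 2).log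
      (by simpa using hs)).neg
    refine h1.congr_deriv ?_
    simp only [id, Real.cot_eq_cos_div_sin]
    field_simp
  · intro x hx
    have hs := (hpos x hx).ne'
    have h1 := ((((hasDerivAt_id x).div_const 2).cos.div ((hasDerivAt_id x).div_const 2).sin
      (by simpa using hs))).const_mul (-(1 / 2))
    have e : (fun x => -(1 / 2) * Real.cot (x / 2)) =
      fun x => -(1 / 2) * (Real.cos (id x / 2) / Real.sin (id x / 2)) := by
      funext x; simp [Real.cot_eq_cos_div_sin]
    rw [e]
    refine h1.congr_deriv ?_
    simp only [id]
    have := Real.sin_sq_add_cos_sq (x / 2)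
    field_simp
    linarith
  · intro x hx
    have hs := hpos x hx
    have := Real.sin_sq_le_one (x / 2)
    apply one_div_le_one_div_of_le <;> nlinarith [sq_nonneg (Real.sin (x / 2)), pow_pos hs 2]

/-! ### Chord lengths and the cotangent kernel -/

theorem norm_exp_sub_exp (x y : ℝ) :
    ‖(Circle.exp x : ℂ) - Circle.exp y‖ = 2 * |Real.sin ((x - y) / 2)| := by
  have h : ‖(Circle.exp x : ℂ) - Circle.exp y‖ ^ 2 = (2 * |Real.sin ((x - y) / 2)|) ^ 2 := by
    rw [← Complex.normSq_eq_norm_sq, Complex.normSq_apply, mul_pow, sq_abs]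
    simp only [Circle.coe_exp, Complex.sub_re, Complex.sub_im, Complex.exp_ofReal_mul_I_re,
      Complex.exp_ofReal_mul_I_im]
    have h1 := Real.cos_sub x y
    have h2 := Real.cos_two_mul ((x - y) / 2)
    rw [mul_div_cancel₀ _ two_ne_zero] at h2
    have h3 := Real.sin_sq_add_cos_sq ((x - y) / 2)
    have h4 := Real.sin_sq_add_cos_sq x
    have h5 := Real.sin_sq_add_cos_sq y
    nlinarith
  exact (pow_left_inj₀ (norm_nonneg _) (by positivity) two_ne_zero).1 h

theorem norm_sub_one_eq (s : Circle) : ‖(s : ℂ) - 1‖ = 2 * |Real.sin (Complex.arg s / 2)| := by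
  have := norm_exp_sub_exp (Complex.arg s) 0
  simpa [Circle.exp_arg] using this

theorem norm_sub_eq_norm_div_sub_one (z w : Circle) :
    ‖(z : ℂ) - w‖ = ‖((z / w : Circle) : ℂ) - 1‖ := by
  have : (z : ℂ) - w = w * (((z / w : Circle) : ℂ) - 1) := by
    rw [Circle.coe_div]; field_simp [w.coe_ne_zero]
  rw [this, norm_mul, Circle.norm_coe, one_mul]

theorem cot_periodic : Function.Periodic Real.cot Real.pi := by
  intro x
  simp [Real.cot_eq_cos_div_sin, Real.cos_add_pi, Real.sin_add_pi, neg_div_neg_eq]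

theorem cot_neg (x : ℝ) : Real.cot (-x) = -Real.cot x := by
  simp [Real.cot_eq_cos_div_sin, div_neg]

/-- The kernel `cot (t / 2)` as a function of `e^{it}`. -/
def cotKernel (s : Circle) : ℝ := Real.cot (Complex.arg s / 2)

/-- Changing `t` by `2π` changes `t / 2` by a period of `cot`, so any choice of angle may replace
the principal argument. -/
theorem cotKernel_exp (t : ℝ) : cotKernel (Circle.exp t) = Real.cot (t / 2) := by
  have h : Circle.exp (Complex.arg (Circle.exp t)) = Circle.exp t := Circle.exp_arg _
  obtain ⟨n, hn⟩ := Circle.exp_eq_exp.1 h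
  rw [cotKernel, hn, show (t + n * (2 * Real.pi)) / 2 = t / 2 + n * Real.pi by ring]
  exact cot_periodic.int_mul n _

theorem cotKernel_inv (s : Circle) : cotKernel s⁻¹ = -cotKernel s := by
  obtain ⟨t, rfl⟩ : ∃ t, Circle.exp t = s := ⟨_, Circle.exp_arg s⟩
  rw [← Circle.exp_neg, cotKernel_exp, cotKernel_exp, neg_div, cot_neg]

theorem abs_cotKernel_mul_norm_le (s : Circle) : |cotKernel s| * ‖(s : ℂ) - 1‖ ≤ 2 := by
  rw [norm_sub_one_eq, cotKernel, Real.cot_eq_cos_div_sin, abs_div]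
  have := Real.abs_cos_le_one (Complex.arg s / 2)
  -- At `s = 1` the kernel is `0`, by the convention for division by zero.
  by_cases h : |Real.sin (Complex.arg s / 2)| = 0
  · rw [h]; simp
  · field_simp; linarith

/-- Jordan's inequality makes the chord comparable to the angle. In this form the singularity can be
cancelled by a Lipschitz difference. -/
theorem abs_cotKernel_mul_abs_arg_le (s : Circle) :
    |cotKernel s| * |Complex.arg s| ≤ 2 * Real.pi := by
  have h0 : |Complex.arg s| ≤ Real.pi := Complex.abs_arg_le_pi _
  have h1 : Real.pi⁻¹ * |Complex.arg s| * 2 ≤ ‖(s : ℂ) - 1‖ := by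
    rw [norm_sub_one_eq]
    have h2 := Real.mul_abs_le_abs_sin (x := Complex.arg s / 2)
      (by rw [abs_div, abs_two]; linarith)
    rw [abs_div, abs_two] at h2
    have : 2 / Real.pi * (|Complex.arg s| / 2) = Real.pi⁻¹ * |Complex.arg s| := by
      field_simp
    linarith
  have h3 := abs_cotKernel_mul_norm_le s
  have h4 := mul_le_mul_of_nonneg_left h1 (abs_nonneg (cotKernel s))
  have h5 : |cotKernel s| * |Complex.arg s| =
    Real.pi / 2 * (|cotKernel s| * (Real.pi⁻¹ * |Complex.arg s| * 2)) := by
    field_simp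
  rw [h5]
  nlinarith [Real.pi_pos]

theorem measurable_arg_coe : Measurable fun s : Circle => Complex.arg (s : ℂ) :=
  Complex.measurable_arg.comp (show Continuous fun z : Circle => (z : ℂ) by fun_prop).measurable

theorem measurable_cotKernel : Measurable cotKernel := by
  have : cotKernel = fun s : Circle =>
      Real.cos (Complex.arg s / 2) / Real.sin (Complex.arg s / 2) := by
    funext s; rw [cotKernel, Real.cot_eq_cos_div_sin]
  rw [this]
  have := measurable_arg_coe
  fun_prop

theorem hilbertTrunc_eq (μ : Measure Circle) (z : Circle) (ε : ℝ) :
    hilbertTrunc μ z ε =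
      ∫ w, {s : Circle | ε < ‖(s : ℂ) - 1‖}.indicator cotKernel (z / w) ∂μ := by
  have hm : MeasurableSet {w : Circle | ε < ‖(z : ℂ) - (w : ℂ)‖} :=
    (isOpen_lt continuous_const (by fun_prop)).measurableSet
  rw [hilbertTrunc, ← integral_indicator hm]
  congr 1
  funext w
  by_cases h : ε < ‖(z : ℂ) - w‖
  · rw [indicator_of_mem (by exact h), indicator_of_mem (by
      rw [mem_ofPred_eq, ← norm_sub_eq_norm_div_sub_one]; exact h), cotKernel, Circle.coe_div]
  · rw [indicator_of_notMem (by exact h), indicator_of_notMem (by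
      rw [mem_ofPred_eq, ← norm_sub_eq_norm_div_sub_one]; exact h)]

/-! ### Regular functions on the circle -/

theorem circleDeriv_exp (f : Circle → ℝ) (x : ℝ) :
    circleDeriv f (Circle.exp x) = deriv (fun x => f (Circle.exp x)) x := by
  have := deriv_comp_const_add (f := fun x => f (Circle.exp x)) (a := x) (x := 0)
  simp only [add_zero] at this
  rw [← this, circleDeriv]
  simp only [Circle.exp_add]

/-- Regularity is only known for `x ↦ g (e^{ix})`; composing with a measurable branch of the angle
recovers `g`. -/
theorem measurable_of_continuous_exp {g : Circle → ℝ}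
    (hg : Continuous fun x : ℝ => g (Circle.exp x)) : Measurable g := by
  have : g = (fun x : ℝ => g (Circle.exp x)) ∘ liftAngle 0 := by
    funext z; simp [exp_liftAngle]
  rw [this]
  exact hg.measurable.comp (measurable_liftAngle 0)

theorem exists_abs_le_of_continuous_exp {g : Circle → ℝ}
    (hg : Continuous fun x : ℝ => g (Circle.exp x)) : ∃ C, 0 ≤ C ∧ ∀ z, |g z| ≤ C := by
  obtain ⟨C, hC⟩ := isCompact_Icc.exists_bound_of_continuousOn
    (s := Icc 0 (0 + 2 * Real.pi)) hg.continuousOn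
  refine ⟨max C 0, le_max_right _ _, fun z => le_max_of_le_left ?_⟩
  have := hC _ (Ico_subset_Icc_self (liftAngle_mem 0 z))
  rwa [exp_liftAngle] at this

theorem continuous_circleDeriv_exp {g : Circle → ℝ} (hg : IsCn 1 g) :
    Continuous fun x : ℝ => circleDeriv g (Circle.exp x) := by
  simp only [circleDeriv_exp]
  exact ContDiff.continuous_deriv hg le_rfl

theorem IsCn.exists_lipschitz {g : Circle → ℝ} (hg : IsCn 1 g) :
    ∃ C, 0 ≤ C ∧ ∀ x y : ℝ, |g (Circle.exp x) - g (Circle.exp y)| ≤ C * |x - y| := by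
  obtain ⟨C, hC0, hC⟩ := exists_abs_le_of_continuous_exp (continuous_circleDeriv_exp hg)
  refine ⟨C, hC0, fun x y => ?_⟩
  refine Convex.norm_image_sub_le_of_norm_deriv_le (f := fun x : ℝ => g (Circle.exp x))
    (s := univ) (fun x _ => (ContDiff.differentiable hg one_ne_zero).differentiableAt)
    (fun x _ => ?_) convex_univ (mem_univ y) (mem_univ x)
  rw [← circleDeriv_exp]
  exact hC _

/-! ### Invariance of the Haar measure -/

instance factTwoPiPos : Fact (0 < 2 * Real.pi) := ⟨Real.two_pi_pos⟩

theorem measurable_toCircle :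
    Measurable (AddCircle.toCircle : AddCircle (2 * Real.pi) → Circle) :=
  AddCircle.continuous_toCircle.measurable

theorem toCircle_mk (x : ℝ) : AddCircle.toCircle (x : AddCircle (2 * Real.pi)) = Circle.exp x := by
  rw [AddCircle.toCircle_apply_mk, div_self Real.two_pi_pos.ne', one_mul]

/-- Translation invariance is inherited from the additive circle. -/
theorem haar_eq_map_toCircle : haar = ENNReal.ofReal (1 / (2 * Real.pi)) •
    (volume : Measure (AddCircle (2 * Real.pi))).map AddCircle.toCircle := by
  have h := AddCircle.measurePreserving_mk (2 * Real.pi) (-Real.pi)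
  rw [haar, ← h.map_eq, Measure.map_map measurable_toCircle h.measurable]
  congr 2
  · funext x
    exact (toCircle_mk x).symm
  · rw [show -Real.pi + 2 * Real.pi = Real.pi by ring]

instance isProbabilityMeasure_haar : IsProbabilityMeasure haar := by
  constructor
  rw [haar_eq_map_toCircle, Measure.smul_apply, Measure.map_apply measurable_toCircle .univ,
    preimage_univ, AddCircle.measure_univ, smul_eq_mul, ← ENNReal.ofReal_mul (by positivity),
    one_div, inv_mul_cancel₀ Real.two_pi_pos.ne', ENNReal.ofReal_one]

theorem exists_toCircle_eq (z : Circle) : ∃ a : AddCircle (2 * Real.pi), AddCircle.toCircle a = z :=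
  ⟨(Complex.arg z : ℝ), by rw [toCircle_mk, Circle.exp_arg]⟩

theorem measurePreserving_haar_of_semiconj {F : Circle → Circle}
    {G : AddCircle (2 * Real.pi) → AddCircle (2 * Real.pi)} (hF : Measurable F)
    (hG : MeasurePreserving G) (h : ∀ x, F (AddCircle.toCircle x) = AddCircle.toCircle (G x)) :
    MeasurePreserving F haar haar := by
  refine ⟨hF, ?_⟩
  nth_rw 1 [haar_eq_map_toCircle]
  rw [Measure.map_smul, Measure.map_map hF measurable_toCircle]
  have : F ∘ AddCircle.toCircle = AddCircle.toCircle ∘ G := funext h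
  rw [this, ← Measure.map_map measurable_toCircle hG.measurable, hG.map_eq, haar_eq_map_toCircle]

theorem measurePreserving_div_haar (z : Circle) :
    MeasurePreserving (fun s : Circle => z / s) haar haar := by
  obtain ⟨a, rfl⟩ := exists_toCircle_eq z
  refine measurePreserving_haar_of_semiconj (by fun_prop)
    (Measure.measurePreserving_sub_left volume a) fun x => ?_
  rw [sub_eq_add_neg, AddCircle.toCircle_add, AddCircle.toCircle_neg, div_eq_mul_inv]

theorem measurePreserving_inv_haar : MeasurePreserving (fun s : Circle => s⁻¹) haar haar := by
  simpa using measurePreserving_div_haar 1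

theorem lintegral_haar {g : Circle → ℝ≥0∞} (hg : Measurable g) :
    ∫⁻ s, g s ∂haar = ENNReal.ofReal (1 / (2 * Real.pi)) *
      ∫⁻ t in Ioc (-Real.pi) Real.pi, g (Circle.exp t) := by
  rw [haar, lintegral_smul_measure, lintegral_map hg Circle.exp.continuous.measurable, smul_eq_mul]

instance nullSingletonClass_haar : NullSingletonClass haar := by
  constructor
  intro z
  rw [haar, Measure.smul_apply, Measure.map_apply Circle.exp.continuous.measurable
    (measurableSet_singleton z)]
  suffices h : volume (Circle.exp ⁻¹' {z}) = 0 by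
    rw [Measure.restrict_apply (Circle.exp.continuous.measurable (measurableSet_singleton z)),
      measure_mono_null inter_subset_left h, smul_zero]
  refine Set.Countable.measure_zero (Set.Countable.mono
    (s₂ := range fun n : ℤ => Complex.arg z + n * (2 * Real.pi)) ?_ (countable_range _)) _
  intro x hx
  rw [mem_preimage, mem_singleton_iff, ← Circle.exp_arg z] at hx
  obtain ⟨n, hn⟩ := Circle.exp_eq_exp.1 hx
  exact ⟨n, hn.symm⟩

/-! ### Existence of the principal value -/

/-- The kernel `cot (t / 2)` cut off at distance `ε` from `1`. -/
def cotTrunc (ε : ℝ) : Circle → ℝ := {s : Circle | ε < ‖(s : ℂ) - 1‖}.indicator cotKernel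

theorem measurable_cotTrunc (ε : ℝ) : Measurable (cotTrunc ε) :=
  measurable_cotKernel.indicator (isOpen_lt continuous_const (by fun_prop)).measurableSet

theorem abs_cotTrunc_le {ε : ℝ} (hε : 0 < ε) (s : Circle) : |cotTrunc ε s| ≤ 2 / ε := by
  by_cases h : ε < ‖(s : ℂ) - 1‖
  · rw [cotTrunc, indicator_of_mem (by exact h), le_div_iff₀ hε]
    exact (mul_le_mul_of_nonneg_left h.le (abs_nonneg _)).trans (abs_cotKernel_mul_norm_le s)
  · rw [cotTrunc, indicator_of_notMem (by exact h), abs_zero]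
    positivity

theorem abs_cotTrunc_le_abs_cotKernel (ε : ℝ) (s : Circle) : |cotTrunc ε s| ≤ |cotKernel s| :=
  norm_indicator_le_norm_self (f := cotKernel) s

theorem cotTrunc_inv (ε : ℝ) (s : Circle) : cotTrunc ε s⁻¹ = -cotTrunc ε s := by
  have : ‖((s⁻¹ : Circle) : ℂ) - 1‖ = ‖(s : ℂ) - 1‖ := by
    have := norm_sub_eq_norm_div_sub_one 1 s
    rw [one_div] at this
    rw [← this, norm_sub_rev, Circle.coe_one]
  by_cases h : ε < ‖(s : ℂ) - 1‖
  · rw [cotTrunc, indicator_of_mem (by rw [mem_ofPred_eq, this]; exact h),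
      indicator_of_mem (by exact h), cotKernel_inv]
  · rw [cotTrunc, indicator_of_notMem (by rw [mem_ofPred_eq, this]; exact h),
      indicator_of_notMem (by exact h), neg_zero]

theorem tendsto_cotTrunc (s : Circle) :
    Tendsto (fun ε => cotTrunc ε s) (𝓝[>] 0) (𝓝 (cotKernel s)) := by
  by_cases h : s = 1
  · subst h
    -- With `cot 0 = 0` the convergence also holds at the singular point, so no exceptional set is
    -- needed.
    have h0 : cotKernel 1 = 0 := by simp [cotKernel, Real.cot_eq_cos_div_sin]
    have : ∀ ε, cotTrunc ε 1 = 0 := fun ε => by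
      simp [cotTrunc, indicator_apply, h0]
    simp only [this, h0, tendsto_const_nhds]
  · have hpos : 0 < ‖(s : ℂ) - 1‖ := by
      rw [norm_pos_iff, sub_ne_zero]
      exact fun h' => h (Circle.coe_eq_one.1 h')
    refine tendsto_const_nhds.congr' ?_
    filter_upwards [nhdsWithin_le_nhds (Iio_mem_nhds hpos)] with ε hε
    rw [cotTrunc, indicator_of_mem (by exact hε)]

theorem integral_withDensity_haar {φ : Circle → ℝ} (hφ : Measurable φ) (h0 : ∀ z, 0 ≤ φ z)
    (g : Circle → ℝ) : ∫ w, g w ∂(haar.withDensity fun z => ENNReal.ofReal (φ z)) =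
      ∫ w, φ w * g w ∂haar := by
  rw [integral_withDensity_eq_integral_toReal_smul hφ.ennreal_ofReal (by simp)]
  simp only [ENNReal.toReal_ofReal (h0 _), smul_eq_mul]

/-- The substitution `s ↦ s⁻¹` preserves Haar measure and the cutoff and changes the sign of the
kernel. Averaging the two expressions leaves a difference of values of `φ`, which vanishes at `s =
1`. -/
theorem hilbertTrunc_withDensity {φ : Circle → ℝ} (hφ : IsCn 1 φ) (h0 : ∀ z, 0 ≤ φ z)
    (z : Circle) {ε : ℝ} (hε : 0 < ε) :
    hilbertTrunc (haar.withDensity fun z => ENNReal.ofReal (φ z)) z ε =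
      1 / 2 * ∫ s, cotTrunc ε s * (φ (z / s) - φ (z * s)) ∂haar := by
  have hc := ContDiff.continuous hφ
  have hm := measurable_of_continuous_exp hc
  obtain ⟨M, hM0, hM⟩ := exists_abs_le_of_continuous_exp hc
  have hk := measurable_cotTrunc ε
  have hint : ∀ f : Circle → Circle, Measurable f →
      Integrable (fun s => cotTrunc ε s * φ (f s)) haar := fun f hf => by
    refine Integrable.of_bound (hk.mul (hm.comp hf)).aestronglyMeasurable
      (2 / ε * M) (Eventually.of_forall fun s => ?_)
    rw [norm_mul]
    exact mul_le_mul (abs_cotTrunc_le hε s) (hM _) (norm_nonneg _) (by positivity)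
  have e1 : hilbertTrunc (haar.withDensity fun z => ENNReal.ofReal (φ z)) z ε =
      ∫ s, cotTrunc ε s * φ (z / s) ∂haar := by
    rw [hilbertTrunc_eq, integral_withDensity_haar hm h0,
      ← (measurePreserving_div_haar z).map_eq, integral_map (by fun_prop)]
    · rw [(measurePreserving_div_haar z).map_eq]
      congr 1
      funext s
      rw [div_div_cancel, mul_comm]
      rfl
    · exact (hm.mul ((measurable_cotTrunc ε).comp (by fun_prop))).aestronglyMeasurable
  have e2 : ∫ s, cotTrunc ε s * φ (z / s) ∂haar = -∫ s, cotTrunc ε s * φ (z * s) ∂haar := by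
    rw [← measurePreserving_inv_haar.map_eq, integral_map (by fun_prop),
      measurePreserving_inv_haar.map_eq, ← integral_neg]
    · congr 1
      funext s
      rw [cotTrunc_inv, div_inv_eq_mul, neg_mul]
    · exact (hk.mul (hm.comp (by fun_prop))).aestronglyMeasurable
  simp only [mul_sub]
  rw [integral_sub (hint _ (by fun_prop)) (hint _ (by fun_prop)), e1]
  linarith

theorem exists_abs_cotKernel_mul_sub_le {φ : Circle → ℝ} (hφ : IsCn 1 φ) :
    ∃ C, ∀ z s : Circle, |cotKernel s * (φ (z / s) - φ (z * s))| ≤ C := by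
  obtain ⟨L, hL0, hL⟩ := hφ.exists_lipschitz
  refine ⟨L * (2 * (2 * Real.pi)), fun z s => ?_⟩
  have h := hL (Complex.arg z - Complex.arg s) (Complex.arg z + Complex.arg s)
  rw [Circle.exp_sub, Circle.exp_add, Circle.exp_arg, Circle.exp_arg,
    show Complex.arg z - Complex.arg s - (Complex.arg z + Complex.arg s) = -2 * Complex.arg s by
      ring, abs_mul, abs_neg, abs_two] at h
  rw [abs_mul]
  calc |cotKernel s| * |φ (z / s) - φ (z * s)|
      ≤ |cotKernel s| * (L * (2 * |Complex.arg s|)) := by gcongr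
    _ = L * (2 * (|cotKernel s| * |Complex.arg s|)) := by ring
    _ ≤ L * (2 * (2 * Real.pi)) :=
      mul_le_mul_of_nonneg_left (mul_le_mul_of_nonneg_left
        (abs_cotKernel_mul_abs_arg_le s) zero_le_two) hL0

/-- Dominated convergence in the symmetrised formula, whose integrand is bounded independently of
the cutoff. -/
theorem IsCn.tendsto_hilbertTrunc {φ : Circle → ℝ} (hφ : IsCn 1 φ) (h0 : ∀ z, 0 ≤ φ z)
    (z : Circle) : ∃ l, Tendsto
      (hilbertTrunc (haar.withDensity fun z => ENNReal.ofReal (φ z)) z) (𝓝[>] 0) (𝓝 l) := by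
  have hm := measurable_of_continuous_exp (ContDiff.continuous hφ)
  obtain ⟨C, hC⟩ := exists_abs_cotKernel_mul_sub_le hφ
  refine ⟨1 / 2 * ∫ s, cotKernel s * (φ (z / s) - φ (z * s)) ∂haar, Tendsto.congr'
    (f₁ := fun ε => 1 / 2 * ∫ s, cotTrunc ε s * (φ (z / s) - φ (z * s)) ∂haar) ?_
    ((tendsto_integral_filter_of_dominated_convergence (fun _ => C) ?_ ?_ ?_ ?_).const_mul _)⟩
  · filter_upwards [self_mem_nhdsWithin] with ε hε
    exact (hilbertTrunc_withDensity hφ h0 z hε).symm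
  · refine Eventually.of_forall fun ε => ((measurable_cotTrunc ε).mul
      ((hm.comp (by fun_prop)).sub (hm.comp (by fun_prop)))).aestronglyMeasurable
  · refine Eventually.of_forall fun ε => Eventually.of_forall fun s => (le_trans ?_ (hC z s))
    rw [abs_mul, norm_mul]
    exact mul_le_mul_of_nonneg_right (abs_cotTrunc_le_abs_cotKernel ε s) (abs_nonneg _)
  · exact integrable_const _
  · exact Eventually.of_forall fun s => (tendsto_cotTrunc s).mul_const _

/-- Uniformity in both `ε` and `z` is what later lets the principal value limit pass through
integration against `μ`. -/
theorem IsCn.exists_abs_hilbertTrunc_le {φ : Circle → ℝ} (hφ : IsCn 1 φ) (h0 : ∀ z, 0 ≤ φ z) :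
    ∃ C, ∀ ε > 0, ∀ z,
      |hilbertTrunc (haar.withDensity fun z => ENNReal.ofReal (φ z)) z ε| ≤ C := by
  obtain ⟨C, hC⟩ := exists_abs_cotKernel_mul_sub_le hφ
  refine ⟨1 / 2 * C, fun ε hε z => ?_⟩
  rw [hilbertTrunc_withDensity hφ h0 z hε, abs_mul, abs_of_pos (by norm_num : (0 : ℝ) < 1 / 2)]
  gcongr
  have := norm_integral_le_of_norm_le_const (μ := haar) (C := C)
    (f := fun s => cotTrunc ε s * (φ (z / s) - φ (z * s))) (Eventually.of_forall fun s => by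
      refine le_trans ?_ (hC z s)
      rw [abs_mul, norm_mul]
      exact mul_le_mul_of_nonneg_right (abs_cotTrunc_le_abs_cotKernel ε s) (abs_nonneg _))
  simpa using this

/-! ### The logarithmic energy as a real number -/

/-- True also at `a = 0`: `⊥` truncates to `0` and `Real.log 0 = 0`. For the negative part the two
conventions disagree there, hence the hypothesis of the next lemma. -/
theorem toENNReal_log_enorm (a : ℂ) :
    (ENNReal.log ‖a‖ₑ).toENNReal = ENNReal.ofReal (Real.log ‖a‖) := by
  by_cases h : a = 0
  · simp [h]
  · rw [← ofReal_norm, ENNReal.log_ofReal_of_pos (norm_pos_iff.2 h), EReal.real_coe_toENNReal]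

theorem toENNReal_neg_log_enorm {a : ℂ} (h : a ≠ 0) :
    (-ENNReal.log ‖a‖ₑ).toENNReal = ENNReal.ofReal (-Real.log ‖a‖) := by
  rw [← ofReal_norm, ENNReal.log_ofReal_of_pos (norm_pos_iff.2 h), ← EReal.coe_neg,
    EReal.real_coe_toENNReal]

theorem log_norm_sub_le (z w : Circle) : Real.log ‖(z : ℂ) - w‖ ≤ Real.log 2 := by
  have h2 : ‖(z : ℂ) - w‖ ≤ 2 := (norm_sub_le _ _).trans (by
    rw [Circle.norm_coe, Circle.norm_coe]; norm_num)
  rcases (norm_nonneg ((z : ℂ) - w)).eq_or_lt with h | h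
  · rw [← h, Real.log_zero]; exact (Real.log_pos one_lt_two).le
  · exact Real.log_le_log h h2

/-- The integral of the negative part of `log |z - w|`. -/
def negLogEnergy (μ : Measure Circle) : ℝ≥0∞ :=
  ∫⁻ z : Circle, ∫⁻ w : Circle, (-ENNReal.log ‖(z : ℂ) - (w : ℂ)‖ₑ).toENNReal ∂μ ∂μ

/-- The integral of the positive part of `log |z - w|`. -/
def posLogEnergy (μ : Measure Circle) : ℝ≥0∞ :=
  ∫⁻ z : Circle, ∫⁻ w : Circle, (ENNReal.log ‖(z : ℂ) - (w : ℂ)‖ₑ).toENNReal ∂μ ∂μ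

theorem energy_eq_parts (Q : Circle → ℝ) (μ : Measure Circle) :
    energy Q μ = ((∫ z, Q z ∂μ : ℝ) : EReal) + (negLogEnergy μ : EReal) - (posLogEnergy μ : EReal) :=
  rfl

theorem posLogEnergy_ne_top (μ : Measure Circle) [IsProbabilityMeasure μ] :
    posLogEnergy μ ≠ ⊤ := by
  refine ne_top_of_le_ne_top (ENNReal.ofReal_ne_top (r := Real.log 2)) ?_
  calc posLogEnergy μ ≤ ∫⁻ _ : Circle, ∫⁻ _ : Circle, ENNReal.ofReal (Real.log 2) ∂μ ∂μ :=
        lintegral_mono fun z => lintegral_mono fun w => by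
          rw [toENNReal_log_enorm]
          exact ENNReal.ofReal_le_ofReal (log_norm_sub_le z w)
    _ = _ := by simp

theorem negLogEnergy_ne_top_of_energy_ne_top {Q : Circle → ℝ} {μ : Measure Circle}
    [IsProbabilityMeasure μ] (h : energy Q μ ≠ ⊤) : negLogEnergy μ ≠ ⊤ := by
  intro hN
  apply h
  rw [energy_eq_parts, hN]
  lift posLogEnergy μ to NNReal using posLogEnergy_ne_top μ with p
  rw [EReal.coe_ennreal_top, EReal.coe_add_top]
  rfl

theorem measurable_log_norm_sub :
    Measurable fun p : Circle × Circle => Real.log ‖(p.1 : ℂ) - p.2‖ :=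
  Real.measurable_log.comp
    (show Continuous fun p : Circle × Circle => ‖(p.1 : ℂ) - p.2‖ by fun_prop).measurable

theorem measurable_neg_log_enorm_sub :
    Measurable fun p : Circle × Circle => (-ENNReal.log ‖(p.1 : ℂ) - p.2‖ₑ).toENNReal :=
  ((ENNReal.measurable_log.comp
    (show Continuous fun p : Circle × Circle => ‖(p.1 : ℂ) - p.2‖ₑ by fun_prop).measurable).neg
    ).ereal_toENNReal

/-- The integrand is `⊤` on the diagonal, so finite energy makes the diagonal a null set. -/
theorem ae_ne_of_negLogEnergy_ne_top {μ : Measure Circle} [SFinite μ]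
    (h : negLogEnergy μ ≠ ⊤) : ∀ᵐ p ∂μ.prod μ, (p.1 : ℂ) - p.2 ≠ 0 := by
  rw [negLogEnergy, ← lintegral_prod _ measurable_neg_log_enorm_sub.aemeasurable] at h
  filter_upwards [ae_lt_top measurable_neg_log_enorm_sub h] with p hp h0
  rw [h0] at hp
  simp at hp

theorem negLogEnergy_eq {μ : Measure Circle} [SFinite μ] (h : negLogEnergy μ ≠ ⊤) :
    negLogEnergy μ = ∫⁻ p, ENNReal.ofReal (-Real.log ‖(p.1 : ℂ) - p.2‖) ∂μ.prod μ := by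
  rw [negLogEnergy, ← lintegral_prod _ measurable_neg_log_enorm_sub.aemeasurable]
  refine lintegral_congr_ae ?_
  filter_upwards [ae_ne_of_negLogEnergy_ne_top h] with p hp
  exact toENNReal_neg_log_enorm hp

theorem posLogEnergy_eq (μ : Measure Circle) [SFinite μ] :
    posLogEnergy μ = ∫⁻ p, ENNReal.ofReal (Real.log ‖(p.1 : ℂ) - p.2‖) ∂μ.prod μ := by
  rw [posLogEnergy, lintegral_prod _ measurable_log_norm_sub.ennreal_ofReal.aemeasurable]
  simp only [toENNReal_log_enorm]

theorem integrable_log_norm_sub {μ : Measure Circle} [IsProbabilityMeasure μ]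
    (h : negLogEnergy μ ≠ ⊤) :
    Integrable (fun p : Circle × Circle => Real.log ‖(p.1 : ℂ) - p.2‖) (μ.prod μ) := by
  refine ⟨measurable_log_norm_sub.aestronglyMeasurable, ?_⟩
  have h1 := h
  have h2 := posLogEnergy_ne_top μ
  rw [negLogEnergy_eq h] at h1
  rw [posLogEnergy_eq] at h2
  refine lt_of_le_of_lt ?_ (ENNReal.add_lt_top.2 ⟨h1.lt_top, h2.lt_top⟩)
  rw [← lintegral_add_right _ measurable_log_norm_sub.ennreal_ofReal]
  refine lintegral_mono fun p => ?_
  dsimp only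
  rw [← ofReal_norm, Real.norm_eq_abs]
  rcases abs_cases (Real.log ‖(p.1 : ℂ) - p.2‖) with h | h <;> rw [h.1]
  · exact le_add_self
  · exact le_self_add

theorem energy_eq_coe (Q : Circle → ℝ) {μ : Measure Circle} [IsProbabilityMeasure μ]
    (h : negLogEnergy μ ≠ ⊤) : energy Q μ =
      ((∫ z, Q z ∂μ - ∫ p, Real.log ‖(p.1 : ℂ) - p.2‖ ∂μ.prod μ : ℝ) : EReal) := by
  rw [energy_eq_parts, integral_eq_lintegral_pos_part_sub_lintegral_neg_part
    (integrable_log_norm_sub h), ← negLogEnergy_eq h, ← posLogEnergy_eq]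
  have h2 := posLogEnergy_ne_top μ
  lift posLogEnergy μ to NNReal using h2 with p
  lift negLogEnergy μ to NNReal using h with n
  simp only [ENNReal.coe_toReal]
  rw [sub_sub_eq_add_sub, EReal.coe_sub, EReal.coe_add]
  rfl

theorem energy_ne_top (Q : Circle → ℝ) {μ : Measure Circle} [IsProbabilityMeasure μ]
    (h : negLogEnergy μ ≠ ⊤) : energy Q μ ≠ ⊤ := by
  rw [energy_eq_coe Q h]
  exact EReal.coe_ne_top _

/-! ### Finite energy of bounded densities -/

theorem measurable_neg_log_enorm_sub_one :
    Measurable fun s : Circle => (-ENNReal.log ‖(s : ℂ) - 1‖ₑ).toENNReal :=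
  (ENNReal.measurable_log.comp
    (show Continuous fun s : Circle => ‖(s : ℂ) - 1‖ₑ by fun_prop).measurable).neg.ereal_toENNReal

theorem lintegral_neg_log_haar_ne_top :
    ∫⁻ s : Circle, (-ENNReal.log ‖(s : ℂ) - 1‖ₑ).toENNReal ∂haar ≠ ⊤ := by
  rw [lintegral_haar measurable_neg_log_enorm_sub_one]
  refine ENNReal.mul_ne_top ENNReal.ofReal_ne_top ?_
  have hint : IntegrableOn (fun t => Real.log 2 + |Real.log t|) (Ioc (-Real.pi) Real.pi) := by
    have h := intervalIntegral.intervalIntegrable_log' (a := -Real.pi) (b := Real.pi)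
    rw [intervalIntegrable_iff_integrableOn_Ioc_of_le (by linarith [Real.pi_pos])] at h
    exact (integrable_const _).add h.abs
  refine ne_top_of_le_ne_top hint.lintegral_lt_top.ne (lintegral_mono_ae ?_)
  have hne : ∀ᵐ t ∂volume.restrict (Ioc (-Real.pi) Real.pi), t ≠ (0 : ℝ) :=
    ae_restrict_of_ae (Measure.ae_ne volume 0)
  filter_upwards [hne, ae_restrict_mem measurableSet_Ioc] with t ht htm
  have habs : |t / 2| ≤ Real.pi / 2 := by
    rw [abs_div, abs_two]
    gcongr
    exact abs_le.2 ⟨htm.1.le, htm.2⟩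
  have hsin := Real.mul_abs_le_abs_sin habs
  have hnorm : ‖(Circle.exp t : ℂ) - 1‖ = 2 * |Real.sin (t / 2)| := by
    simpa using norm_exp_sub_exp t 0
  -- Jordan's inequality gives the lower bound `2 |t| / π`, and `π ≤ 4`.
  have hle : |t| / 2 ≤ ‖(Circle.exp t : ℂ) - 1‖ := by
    rw [hnorm]
    rw [abs_div, abs_two] at hsin
    have h4 : 1 / 2 ≤ 2 / Real.pi := by
      rw [div_le_div_iff₀ two_pos Real.pi_pos]; linarith [Real.pi_le_four]
    nlinarith [abs_nonneg t]
  have hpos : 0 < |t| / 2 := by positivity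
  rw [toENNReal_neg_log_enorm (norm_pos_iff.1 (hpos.trans_le hle))]
  refine ENNReal.ofReal_le_ofReal ?_
  have := Real.log_le_log hpos hle
  rw [Real.log_div (abs_pos.2 ht).ne' two_ne_zero, Real.log_abs] at this
  linarith [neg_abs_le (Real.log t)]

/-- By invariance of Haar measure, the logarithmic potential of a density at most `M` is at most `M`
times one finite constant, uniformly in `z`. -/
theorem negLogEnergy_withDensity_ne_top {φ : Circle → ℝ} (hφ : Measurable φ) {M : ℝ}
    (hM : ∀ z, φ z ≤ M)
    [IsProbabilityMeasure (haar.withDensity fun z => ENNReal.ofReal (φ z))] :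
    negLogEnergy (haar.withDensity fun z => ENNReal.ofReal (φ z)) ≠ ⊤ := by
  set μ := haar.withDensity fun z => ENNReal.ofReal (φ z) with hμ
  set g : Circle → ℝ≥0∞ := fun s => (-ENNReal.log ‖(s : ℂ) - 1‖ₑ).toENNReal with hg
  have hgm : Measurable g := measurable_neg_log_enorm_sub_one
  refine ne_top_of_le_ne_top (ENNReal.mul_ne_top (ENNReal.ofReal_ne_top (r := M))
    lintegral_neg_log_haar_ne_top) ?_
  have key : ∀ z : Circle, ∫⁻ w : Circle, (-ENNReal.log ‖(z : ℂ) - (w : ℂ)‖ₑ).toENNReal ∂μ ≤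
      ENNReal.ofReal M * ∫⁻ s, g s ∂haar := fun z => by
    have e : ∀ w : Circle, (-ENNReal.log ‖(z : ℂ) - (w : ℂ)‖ₑ).toENNReal = g (z / w) := fun w => by
      rw [hg, ← ofReal_norm, norm_sub_eq_norm_div_sub_one, ofReal_norm]
    simp only [e]
    have hgz : Measurable fun w => g (z / w) := hgm.comp (by fun_prop)
    rw [hμ, lintegral_withDensity_eq_lintegral_mul _ hφ.ennreal_ofReal hgz]
    calc _ ≤ ∫⁻ w, ENNReal.ofReal M * g (z / w) ∂haar :=
          lintegral_mono fun w => mul_le_mul_left (ENNReal.ofReal_le_ofReal (hM w)) _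
      _ = ENNReal.ofReal M * ∫⁻ w, g (z / w) ∂haar :=
          lintegral_const_mul _ hgz
      _ = _ := by rw [(measurePreserving_div_haar z).lintegral_comp hgm]
  calc negLogEnergy μ ≤ ∫⁻ _, ENNReal.ofReal M * ∫⁻ s, g s ∂haar ∂μ := lintegral_mono key
    _ = _ := by simp [hg]

/-! ### Monotone transport on the line -/

section MonotoneTransport

open ProbabilityTheory

theorem continuous_cdf (m : Measure ℝ) [IsProbabilityMeasure m] [NullSingletonClass m] :
    Continuous (cdf m) := by
  refine continuous_iff_continuousAt.2 fun x => ?_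
  rw [(monotone_cdf m).continuousAt_iff_leftLim_eq_rightLim, StieltjesFunction.rightLim_eq]
  have h := (cdf m).measure_singleton x
  rw [measure_cdf, measure_singleton, eq_comm, ENNReal.ofReal_eq_zero] at h
  exact le_antisymm ((monotone_cdf m).leftLim_le le_rfl) (sub_nonpos.1 h)

/-- The image of an atomless law under its own distribution function is uniform: the sublevel set is
a half-line, and by continuity the value at its endpoint is exactly `r`. -/
theorem measure_cdf_le (m : Measure ℝ) [IsProbabilityMeasure m] [NullSingletonClass m] {r : ℝ}
    (h0 : 0 ≤ r) (h1 : r ≤ 1) : m {x | cdf m x ≤ r} = ENNReal.ofReal r := by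
  -- For `r = 1` the sublevel set is the whole line and has no supremum.
  rcases h1.eq_or_lt with rfl | h1
  · have : {x | cdf m x ≤ 1} = univ := eq_univ_of_forall fun x => cdf_le_one m x
    rw [this, measure_univ, ENNReal.ofReal_one]
  have hc := continuous_cdf m
  rcases eq_empty_or_nonempty {x | cdf m x ≤ r} with he | hne
  · have hr : r ≤ 0 := ge_of_tendsto (tendsto_cdf_atBot m) (Eventually.of_forall fun x => by
      by_contra! hx
      exact (he ▸ (show x ∈ {x | cdf m x ≤ r} from hx.le) : x ∈ (∅ : Set ℝ)))
    rw [he, measure_empty, ENNReal.ofReal_of_nonpos hr]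
  · have hbdd : BddAbove {x | cdf m x ≤ r} := by
      obtain ⟨b, hb⟩ := ((tendsto_cdf_atTop m).eventually (lt_mem_nhds h1)).exists
      refine ⟨b, fun x hx => ?_⟩
      by_contra! hbx
      exact absurd ((monotone_cdf m hbx.le).trans hx) (not_le.2 hb)
    have hmem := (isClosed_le hc continuous_const).csSup_mem hne hbdd
    set x₁ := sSup {x | cdf m x ≤ r}
    have hS : {x | cdf m x ≤ r} = Iic x₁ := by
      ext x
      exact ⟨fun hx => le_csSup hbdd hx, fun hx => (monotone_cdf m hx).trans hmem⟩
    have heq : cdf m x₁ = r := by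
      refine le_antisymm hmem (not_lt.1 fun hlt => ?_)
      have hev : ∀ᶠ x in 𝓝[>] x₁, cdf m x < r :=
        (hc.continuousAt.eventually (gt_mem_nhds hlt)).filter_mono nhdsWithin_le_nhds
      obtain ⟨x, hx, hx'⟩ := (hev.and self_mem_nhdsWithin).exists
      exact absurd (le_csSup hbdd (show x ∈ {x | cdf m x ≤ r} from hx.le)) (not_le.2 hx')
    rw [hS, ← ofReal_cdf, heq]

/-- `T` is the quantile function of `ν` composed with the distribution function of `m`. Taking the
infimum inside `[c, d]` confines `T` to that interval at every point, not just almost everywhere. -/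
theorem exists_monotone_transport (m ν : Measure ℝ) [IsProbabilityMeasure m]
    [NullSingletonClass m] [IsProbabilityMeasure ν] {c d : ℝ} (hcd : c ≤ d)
    (hν : ∀ᵐ y ∂ν, y ∈ Icc c d) :
    ∃ T : ℝ → ℝ, Monotone T ∧ (∀ x, T x ∈ Icc c d) ∧ m.map T = ν := by
  have hd1 : ∀ t, d ≤ t → ν (Iic t) = 1 := fun t ht => by
    rw [← prob_compl_eq_zero_iff measurableSet_Iic, ← mem_ae_iff]
    filter_upwards [hν] with y hy using hy.2.trans ht
  have hc0 : ∀ t, t < c → ν (Iic t) = 0 := fun t ht => by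
    refine measure_eq_zero_iff_ae_notMem.2 ?_
    filter_upwards [hν] with y hy hy' using absurd (hy.1.trans hy') (not_le.2 ht)
  have hqd : cdf ν d = 1 := by rw [cdf_eq_real, measureReal_def, hd1 d le_rfl, ENNReal.toReal_one]
  let S : ℝ → Set ℝ := fun x => {t | t ∈ Icc c d ∧ cdf m x ≤ cdf ν t}
  have hSne : ∀ x, (S x).Nonempty := fun x =>
    ⟨d, right_mem_Icc.2 hcd, hqd ▸ cdf_le_one m x⟩
  have hSb : ∀ x, BddBelow (S x) := fun x => ⟨c, fun t ht => ht.1.1⟩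
  have hTmem : ∀ x, sInf (S x) ∈ Icc c d := fun x =>
    ⟨le_csInf (hSne x) fun t ht => ht.1.1,
      csInf_le (hSb x) ⟨right_mem_Icc.2 hcd, hqd ▸ cdf_le_one m x⟩⟩
  have hTmono : Monotone fun x => sInf (S x) := fun x y hxy =>
    csInf_le_csInf (hSb x) (hSne y) fun t ht => ⟨ht.1, (monotone_cdf m hxy).trans ht.2⟩
  -- Right continuity makes the infimum attained, so `T x ≤ t` is equivalent to `cdf m x ≤ cdf ν t`
  -- for `t` in `[c, d]`.
  have hattain : ∀ x, cdf m x ≤ cdf ν (sInf (S x)) := fun x => by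
    have hr := ((cdf ν).right_continuous (sInf (S x))).mono_left
      (nhdsWithin_mono _ Ioi_subset_Ici_self)
    refine ge_of_tendsto hr ?_
    filter_upwards [self_mem_nhdsWithin] with t ht
    obtain ⟨t', ht', hlt⟩ := exists_lt_of_csInf_lt (hSne x) ht
    exact ht'.2.trans (monotone_cdf ν hlt.le)
  refine ⟨fun x => sInf (S x), hTmono, hTmem, Measure.ext_of_Iic _ _ fun t => ?_⟩
  rw [Measure.map_apply hTmono.measurable measurableSet_Iic]
  rcases lt_or_ge t c with htc | htc
  · rw [hc0 t htc, show (fun x => sInf (S x)) ⁻¹' Iic t = ∅ from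
      eq_empty_of_forall_notMem fun x hx => absurd ((hTmem x).1.trans hx) (not_le.2 htc),
      measure_empty]
  rcases le_or_gt d t with htd | htd
  · rw [hd1 t htd, show (fun x => sInf (S x)) ⁻¹' Iic t = univ from
      eq_univ_of_forall fun x => (hTmem x).2.trans htd, measure_univ]
  rw [← ofReal_cdf, ← measure_cdf_le m (cdf_nonneg ν t) (cdf_le_one ν t)]
  congr 1
  ext x
  exact ⟨fun hx => (hattain x).trans (monotone_cdf ν hx),
    fun hx => csInf_le (hSb x) ⟨⟨htc, htd.le⟩, hx⟩⟩

end MonotoneTransport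

/-! ### Optimality of monotone transport for the quadratic cost -/

/-- Layer cake: the integrand is the area of the rectangle `(a, q.1) × (c, q.2)`, and Tonelli
exchanges the integrals. -/
theorem lintegral_ofReal_sub_mul (γ : Measure (ℝ × ℝ)) [SFinite γ] (a c : ℝ) :
    ∫⁻ q, ENNReal.ofReal (q.1 - a) * ENNReal.ofReal (q.2 - c) ∂γ =
      ∫⁻ r, γ {q | r.1 < q.1 ∧ r.2 < q.2}
        ∂(volume.restrict (Ioi a)).prod (volume.restrict (Ioi c)) := by
  have hE : MeasurableSet {p : (ℝ × ℝ) × (ℝ × ℝ) | p.2.1 < p.1.1 ∧ p.2.2 < p.1.2} :=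
    ((isOpen_lt (by fun_prop) (by fun_prop)).and
      (isOpen_lt (by fun_prop) (by fun_prop))).measurableSet
  have h1 := Measure.prod_apply (μ := γ)
    (ν := (volume.restrict (Ioi a)).prod (volume.restrict (Ioi c))) hE
  rw [Measure.prod_apply_symm hE] at h1
  refine Eq.trans ?_ h1.symm
  refine lintegral_congr fun q => ?_
  have : Prod.mk q ⁻¹' {p : (ℝ × ℝ) × (ℝ × ℝ) | p.2.1 < p.1.1 ∧ p.2.2 < p.1.2} =
      Iio q.1 ×ˢ Iio q.2 := rfl
  rw [this, Measure.prod_prod, Measure.restrict_apply measurableSet_Iio,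
    Measure.restrict_apply measurableSet_Iio, Iio_inter_Ioi, Iio_inter_Ioi, Real.volume_Ioo,
    Real.volume_Ioo]

/-- Any coupling gives a quadrant at most the smaller of its two marginal masses, and the monotone
coupling attains this bound. -/
theorem lintegral_mul_le_of_monotone {m : Measure ℝ} [IsFiniteMeasure m] {T : ℝ → ℝ}
    (hT : Monotone T) {γ : Measure (ℝ × ℝ)} [SFinite γ] (h1 : γ.map Prod.fst = m)
    (h2 : γ.map Prod.snd = m.map T) (a c : ℝ) :
    ∫⁻ q, ENNReal.ofReal (q.1 - a) * ENNReal.ofReal (q.2 - c) ∂γ ≤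
      ∫⁻ x, ENNReal.ofReal (x - a) * ENNReal.ofReal (T x - c) ∂m := by
  have hg : Measurable fun x => (x, T x) := measurable_id.prodMk hT.measurable
  have e : ∫⁻ x, ENNReal.ofReal (x - a) * ENNReal.ofReal (T x - c) ∂m =
      ∫⁻ q, ENNReal.ofReal (q.1 - a) * ENNReal.ofReal (q.2 - c) ∂(m.map fun x => (x, T x)) := by
    rw [lintegral_map (by fun_prop) hg]
  rw [e, lintegral_ofReal_sub_mul, lintegral_ofReal_sub_mul]
  refine lintegral_mono fun r => ?_
  have hset : MeasurableSet {q : ℝ × ℝ | r.1 < q.1 ∧ r.2 < q.2} :=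
    ((isOpen_lt (by fun_prop) (by fun_prop)).and
      (isOpen_lt (by fun_prop) (by fun_prop))).measurableSet
  have l1 : γ {q | r.1 < q.1 ∧ r.2 < q.2} ≤ m (Ioi r.1) := by
    rw [← h1, Measure.map_apply measurable_fst measurableSet_Ioi]
    exact measure_mono fun q hq => hq.1
  have l2 : γ {q | r.1 < q.1 ∧ r.2 < q.2} ≤ m (T ⁻¹' Ioi r.2) := by
    rw [← Measure.map_apply hT.measurable measurableSet_Ioi, ← h2,
      Measure.map_apply measurable_snd measurableSet_Ioi]
    exact measure_mono fun q hq => hq.2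
  rw [Measure.map_apply hg hset]
  -- Upper sets of the line are nested, so the intersection of these two is one of them.
  rcases (isUpperSet_Ioi r.1).total ((isUpperSet_Ioi r.2).preimage hT) with h | h
  · exact l1.trans (measure_mono fun x hx => ⟨hx, h hx⟩)
  · exact l2.trans (measure_mono fun x hx => ⟨h hx, hx⟩)

theorem integral_mul_le_of_monotone {m : Measure ℝ} [IsProbabilityMeasure m] {T : ℝ → ℝ}
    (hT : Monotone T) {a b c d : ℝ} (hm : ∀ᵐ x ∂m, x ∈ Icc a b) (hTcd : ∀ x, T x ∈ Icc c d)
    {γ : Measure (ℝ × ℝ)} [SFinite γ] (h1 : γ.map Prod.fst = m) (h2 : γ.map Prod.snd = m.map T) :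
    ∫ q, (q.1 - a) * (q.2 - c) ∂γ ≤ ∫ x, (x - a) * (T x - c) ∂m := by
  have hTm := hT.measurable
  have hpm : Measurable fun x => (x - a) * (T x - c) := by fun_prop
  have a1 : ∀ᵐ q ∂γ, q.1 ∈ Icc a b := ae_of_ae_map measurable_fst.aemeasurable (h1 ▸ hm)
  have a2 : ∀ᵐ q ∂γ, q.2 ∈ Icc c d := by
    refine ae_of_ae_map measurable_snd.aemeasurable (h2 ▸ ?_)
    exact (ae_map_iff hTm.aemeasurable measurableSet_Icc).2 (Eventually.of_forall hTcd)
  rw [integral_eq_lintegral_of_nonneg_ae _ (by fun_prop),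
    integral_eq_lintegral_of_nonneg_ae _ hpm.aestronglyMeasurable]
  · refine ENNReal.toReal_mono ?_ ?_
    · refine ne_top_of_le_ne_top (ENNReal.ofReal_ne_top (r := (b - a) * (d - c))) ?_
      calc ∫⁻ x, ENNReal.ofReal ((x - a) * (T x - c)) ∂m
          ≤ ∫⁻ x, ENNReal.ofReal ((b - a) * (d - c)) ∂m := by
            refine lintegral_mono_ae ?_
            filter_upwards [hm] with x hx
            refine ENNReal.ofReal_le_ofReal ?_
            have := hTcd x
            exact mul_le_mul (by linarith [hx.2]) (by linarith [this.2]) (by linarith [this.1])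
              (by linarith [hx.1, hx.2])
        _ = _ := by simp
    · have key := lintegral_mul_le_of_monotone hT h1 h2 a c
      convert key using 1
      · refine lintegral_congr_ae ?_
        filter_upwards [a1] with q hq
        exact ENNReal.ofReal_mul (by linarith [hq.1])
      · refine lintegral_congr_ae ?_
        filter_upwards [hm] with q hq
        exact ENNReal.ofReal_mul (by linarith [hq.1])
  · filter_upwards [hm] with x hx
    exact mul_nonneg (by linarith [hx.1]) (by linarith [(hTcd x).1])
  · filter_upwards [a1, a2] with x hx hx'
    exact mul_nonneg (by linarith [hx.1]) (by linarith [hx'.1])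

/-- Only the product term depends on the coupling, so minimising the cost means maximising that
term. -/
theorem integral_sq_sub_eq {m ν : Measure ℝ} {γ : Measure (ℝ × ℝ)} [IsProbabilityMeasure γ]
    (h1 : γ.map Prod.fst = m) (h2 : γ.map Prod.snd = ν) {a b c d : ℝ}
    (hm : ∀ᵐ x ∂m, x ∈ Icc a b) (hν : ∀ᵐ x ∂ν, x ∈ Icc c d) :
    ∫ q, (q.1 - q.2) ^ 2 ∂γ = ∫ x, ((x - a) ^ 2 + 2 * (a - c) * (x - a)) ∂m +
      ∫ y, ((y - c) ^ 2 - 2 * (a - c) * (y - c)) ∂ν + (a - c) ^ 2 -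
      2 * ∫ q, (q.1 - a) * (q.2 - c) ∂γ := by
  have a1 : ∀ᵐ q ∂γ, q.1 ∈ Icc a b := ae_of_ae_map measurable_fst.aemeasurable (h1 ▸ hm)
  have a2 : ∀ᵐ q ∂γ, q.2 ∈ Icc c d := ae_of_ae_map measurable_snd.aemeasurable (h2 ▸ hν)
  have hint : ∀ f : ℝ × ℝ → ℝ, Continuous f → Integrable f γ := fun f hf => by
    obtain ⟨C, hC⟩ := (isCompact_Icc.prod isCompact_Icc).exists_bound_of_continuousOn
      (s := Icc a b ×ˢ Icc c d) hf.continuousOn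
    refine Integrable.of_bound hf.aestronglyMeasurable C ?_
    filter_upwards [a1, a2] with q hq hq'
    exact hC q ⟨hq, hq'⟩
  have e1 : ∫ x, ((x - a) ^ 2 + 2 * (a - c) * (x - a)) ∂m =
      ∫ q, ((q.1 - a) ^ 2 + 2 * (a - c) * (q.1 - a)) ∂γ := by
    rw [← h1, integral_map measurable_fst.aemeasurable (by fun_prop)]
  have e2 : ∫ y, ((y - c) ^ 2 - 2 * (a - c) * (y - c)) ∂ν =
      ∫ q, ((q.2 - c) ^ 2 - 2 * (a - c) * (q.2 - c)) ∂γ := by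
    rw [← h2, integral_map measurable_snd.aemeasurable (by fun_prop)]
  have e3 : (a - c) ^ 2 = ∫ _, (a - c) ^ 2 ∂γ := by simp
  rw [e1, e2, ← integral_add (hint _ (by fun_prop)) (hint _ (by fun_prop)), e3,
    ← integral_add (hint _ (by fun_prop)) (hint _ (by fun_prop)), ← integral_const_mul,
    ← integral_sub (hint _ (by fun_prop)) (hint _ (by fun_prop))]
  congr 1
  funext q
  ring

theorem lintegral_enorm_rpow_two_eq {γ : Measure (ℝ × ℝ)} [IsProbabilityMeasure γ] {a b c d : ℝ}
    (a1 : ∀ᵐ q ∂γ, q.1 ∈ Icc a b) (a2 : ∀ᵐ q ∂γ, q.2 ∈ Icc c d) :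
    ∫⁻ q, ‖q.1 - q.2‖ₑ ^ (2 : ℝ) ∂γ = ENNReal.ofReal (∫ q, (q.1 - q.2) ^ 2 ∂γ) := by
  rw [ofReal_integral_eq_lintegral_ofReal]
  · refine lintegral_congr fun q => ?_
    rw [← ofReal_norm, ENNReal.ofReal_rpow_of_nonneg (norm_nonneg _) zero_le_two, Real.rpow_two,
      Real.norm_eq_abs, sq_abs]
  · obtain ⟨C, hC⟩ := (isCompact_Icc.prod isCompact_Icc).exists_bound_of_continuousOn
      (s := Icc a b ×ˢ Icc c d) (f := fun q : ℝ × ℝ => (q.1 - q.2) ^ 2) (by fun_prop)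
    refine Integrable.of_bound (by fun_prop) C ?_
    filter_upwards [a1, a2] with q hq hq'
    exact hC q ⟨hq, hq'⟩
  · exact Eventually.of_forall fun q => sq_nonneg _

theorem wasserstein_two_eq {m : Measure ℝ} [IsProbabilityMeasure m] {T : ℝ → ℝ}
    (hT : Monotone T) {a b c d : ℝ} (hm : ∀ᵐ x ∂m, x ∈ Icc a b) (hTcd : ∀ x, T x ∈ Icc c d) :
    wasserstein 2 m (m.map T) = ENNReal.ofReal (√(∫ x, (x - T x) ^ 2 ∂m)) := by
  have hTm := hT.measurable
  have hg : Measurable fun x => (x, T x) := measurable_id.prodMk hTm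
  have hν : ∀ᵐ x ∂m.map T, x ∈ Icc c d :=
    (ae_map_iff hTm.aemeasurable measurableSet_Icc).2 (Eventually.of_forall hTcd)
  have hcost : ∀ γ : Measure (ℝ × ℝ), γ.map Prod.fst = m ∧ γ.map Prod.snd = m.map T →
      ∫⁻ q, ‖q.1 - q.2‖ₑ ^ (2 : ℝ) ∂γ = ENNReal.ofReal (∫ q, (q.1 - q.2) ^ 2 ∂γ) ∧
      ∫ x, (x - T x) ^ 2 ∂m ≤ ∫ q, (q.1 - q.2) ^ 2 ∂γ := by
    rintro γ ⟨h1, h2⟩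
    have hγ : IsProbabilityMeasure γ := ⟨by
      rw [← preimage_univ (f := Prod.fst), ← Measure.map_apply measurable_fst .univ, h1,
        measure_univ]⟩
    refine ⟨lintegral_enorm_rpow_two_eq
      (ae_of_ae_map measurable_fst.aemeasurable (h1 ▸ hm))
      (ae_of_ae_map measurable_snd.aemeasurable (h2 ▸ hν)), ?_⟩
    have hγ₀ : IsProbabilityMeasure (m.map fun x => (x, T x)) :=
      Measure.isProbabilityMeasure_map hg.aemeasurable
    have e0 := integral_sq_sub_eq (γ := m.map fun x => (x, T x)) (m := m) (ν := m.map T)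
      (by rw [Measure.map_map measurable_fst hg]; exact Measure.map_id)
      (by rw [Measure.map_map measurable_snd hg]; rfl) hm hν
    rw [integral_map hg.aemeasurable (by fun_prop), integral_map hg.aemeasurable (by fun_prop)] at e0
    rw [e0, integral_sq_sub_eq h1 h2 hm hν]
    linarith [integral_mul_le_of_monotone hT hm hTcd h1 h2]
  have hinf : (⨅ (γ : Measure (ℝ × ℝ)) (_ : γ.map Prod.fst = m ∧ γ.map Prod.snd = m.map T),
      ∫⁻ q, ‖q.1 - q.2‖ₑ ^ (2 : ℝ) ∂γ) = ENNReal.ofReal (∫ x, (x - T x) ^ 2 ∂m) := by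
    refine le_antisymm ?_ (le_iInf₂ fun γ hγ => ?_)
    · have h0 : (m.map fun x => (x, T x)).map Prod.fst = m ∧
          (m.map fun x => (x, T x)).map Prod.snd = m.map T :=
        ⟨by rw [Measure.map_map measurable_fst hg]; exact Measure.map_id,
          by rw [Measure.map_map measurable_snd hg]; rfl⟩
      refine (iInf₂_le (f := fun (γ : Measure (ℝ × ℝ))
        (_ : γ.map Prod.fst = m ∧ γ.map Prod.snd = m.map T) =>
          ∫⁻ q, ‖q.1 - q.2‖ₑ ^ (2 : ℝ) ∂γ) _ h0).trans ?_
      rw [(hcost _ h0).1, integral_map hg.aemeasurable (by fun_prop)]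
    · rw [(hcost γ hγ).1]
      exact ENNReal.ofReal_le_ofReal (hcost γ hγ).2
  rw [wasserstein, hinf, ENNReal.ofReal_rpow_of_nonneg (integral_nonneg fun x => sq_nonneg _)
    (by norm_num), Real.sqrt_eq_rpow]

/-! ### Lifts with equal means -/

theorem liftAngle_eq_zero_add (u : ℝ) (z : Circle) :
    liftAngle u z = toIcoMod Real.two_pi_pos 0 (Complex.arg z - u) + u :=
  toIcoMod_eq_sub _ _ _

theorem liftAngle_add_two_pi (u : ℝ) (z : Circle) :
    liftAngle (u + 2 * Real.pi) z = liftAngle u z + 2 * Real.pi := by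
  rw [liftAngle_eq_zero_add, liftAngle_eq_zero_add,
    show Complex.arg z - (u + 2 * Real.pi) = Complex.arg z - u - 2 * Real.pi by ring, toIcoMod_sub]
  ring

/-- The lifted angle of `z` jumps only when the cut `e^{iu}` passes through `z`. -/
theorem continuousAt_liftAngle {u : ℝ} {z : Circle} (h : z ≠ Circle.exp u) :
    ContinuousAt (fun u => liftAngle u z) u := by
  simp only [liftAngle_eq_zero_add]
  refine ContinuousAt.add ?_ continuousAt_id
  refine ContinuousAt.comp (g := toIcoMod Real.two_pi_pos 0) (f := fun u => Complex.arg z - u)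
    (continuousAt_toIcoMod _ _ fun hmod => h ?_) (by fun_prop)
  rw [AddCommGroup.modEq_iff_eq_add_zsmul] at hmod
  obtain ⟨n, hn⟩ := hmod
  rw [← Circle.exp_arg z]
  refine Circle.exp_eq_exp.2 ⟨-n, ?_⟩
  rw [zsmul_eq_mul] at hn
  push_cast
  linarith

theorem abs_liftAngle_le (u : ℝ) (z : Circle) : |liftAngle u z| ≤ |u| + 2 * Real.pi := by
  have h := liftAngle_mem u z
  rw [abs_le]
  constructor
  · linarith [h.1, neg_abs_le u, Real.pi_pos]
  · linarith [h.2, le_abs_self u]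

theorem integrable_liftAngle (μ : Measure Circle) [IsFiniteMeasure μ] (u : ℝ) :
    Integrable (liftAngle u) μ :=
  Integrable.of_bound (measurable_liftAngle u).aestronglyMeasurable _
    (Eventually.of_forall (abs_liftAngle_le u))

theorem integral_id_lift (μ : Measure Circle) (u : ℝ) :
    ∫ x, x ∂(lift μ u) = ∫ z, liftAngle u z ∂μ := by
  rw [lift, integral_map (measurable_liftAngle u).aemeasurable (by fun_prop)]

theorem integral_liftAngle_add_two_pi (μ : Measure Circle) [IsProbabilityMeasure μ] (u : ℝ) :
    ∫ z, liftAngle (u + 2 * Real.pi) z ∂μ = ∫ z, liftAngle u z ∂μ + 2 * Real.pi := by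
  simp only [liftAngle_add_two_pi]
  rw [integral_add (integrable_liftAngle μ u) (integrable_const _)]
  simp

theorem continuous_integral_liftAngle (μ : Measure Circle) [IsProbabilityMeasure μ]
    [NullSingletonClass μ] : Continuous fun u => ∫ z, liftAngle u z ∂μ := by
  refine continuous_iff_continuousAt.2 fun u => ?_
  refine continuousAt_of_dominated (bound := fun _ => |u| + 1 + 2 * Real.pi)
    (Eventually.of_forall fun u => (measurable_liftAngle u).aestronglyMeasurable) ?_
    (integrable_const _) ?_
  · filter_upwards [Metric.ball_mem_nhds u one_pos] with x hx
    refine Eventually.of_forall fun z => (abs_liftAngle_le x z).trans ?_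
    rw [Metric.mem_ball, Real.dist_eq] at hx
    have := abs_sub_abs_le_abs_sub x u
    linarith
  · filter_upwards [Measure.ae_ne μ (Circle.exp u)] with z hz
    exact continuousAt_liftAngle hz

/-- One turn of the base point moves the mean of the lift continuously by `2π`. Both means at base
point `0` lie in `[0, 2π]`, so the mean for `μ` crosses that for `ν` taken at `v = 0` or at `v =
2π`. -/
theorem exists_sameMean (μ ν : Measure Circle) [IsProbabilityMeasure μ] [IsProbabilityMeasure ν]
    [NullSingletonClass μ] : ∃ u v, SameMean μ ν u v := by
  have hpi := Real.two_pi_pos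
  have hrange : ∀ {ξ : Measure Circle} [IsProbabilityMeasure ξ],
      0 ≤ ∫ z, liftAngle 0 z ∂ξ ∧ ∫ z, liftAngle 0 z ∂ξ ≤ 2 * Real.pi := fun {ξ} _ => by
    constructor
    · exact integral_nonneg fun z => (liftAngle_mem 0 z).1
    · have := integral_mono (integrable_liftAngle ξ 0) (integrable_const (2 * Real.pi))
        fun z => by simpa using (liftAngle_mem 0 z).2.le
      simpa using this
  have hμ := hrange (ξ := μ)
  have hν := hrange (ξ := ν)
  have eμ := integral_liftAngle_add_two_pi μ 0
  have eν := integral_liftAngle_add_two_pi ν 0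
  rw [zero_add] at eμ eν
  have ivt := intermediate_value_Icc hpi.le (continuous_integral_liftAngle μ).continuousOn
  simp only [SameMean, integral_id_lift]
  rcases le_or_gt (∫ z, liftAngle 0 z ∂μ) (∫ z, liftAngle 0 z ∂ν) with h | h
  · obtain ⟨u, hu, hu'⟩ := ivt ⟨h, by rw [eμ]; linarith⟩
    exact ⟨u, 0, hu, ⟨le_rfl, hpi.le⟩, hu'⟩
  · obtain ⟨u, hu, hu'⟩ := ivt (show ∫ z, liftAngle (2 * Real.pi) z ∂ν ∈ _ from
      ⟨by rw [eν]; linarith, by rw [eμ, eν]; linarith⟩)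
    exact ⟨u, 2 * Real.pi, hu, ⟨hpi.le, le_rfl⟩, hu'⟩

/-! ### Integration against the Hilbert transform -/

theorem integrable_of_abs_le {α : Type*} [MeasurableSpace α] {μ : Measure α} [IsFiniteMeasure μ]
    {f : α → ℝ} (hf : Measurable f) {C : ℝ} (hC : ∀ x, |f x| ≤ C) : Integrable f μ :=
  Integrable.of_bound hf.aestronglyMeasurable C (Eventually.of_forall hC)

/-- Cauchy–Schwarz, from the discriminant of `t ↦ ∫ (t g + f)²`. -/
theorem sq_integral_mul_le {α : Type*} [MeasurableSpace α] {μ : Measure α} {f g : α → ℝ}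
    (hf : Integrable (fun x => f x ^ 2) μ) (hg : Integrable (fun x => g x ^ 2) μ)
    (hfg : Integrable (fun x => f x * g x) μ) :
    (∫ x, f x * g x ∂μ) ^ 2 ≤ (∫ x, f x ^ 2 ∂μ) * ∫ x, g x ^ 2 ∂μ := by
  have h : ∀ t : ℝ, 0 ≤ (∫ x, g x ^ 2 ∂μ) * (t * t) + (2 * ∫ x, f x * g x ∂μ) * t +
      ∫ x, f x ^ 2 ∂μ := fun t => by
    have e : (∫ x, g x ^ 2 ∂μ) * (t * t) + (2 * ∫ x, f x * g x ∂μ) * t + ∫ x, f x ^ 2 ∂μ =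
        ∫ x, (t * t * g x ^ 2 + 2 * t * (f x * g x) + f x ^ 2) ∂μ := by
      have i : Integrable (fun x => t * t * g x ^ 2 + 2 * t * (f x * g x)) μ :=
        (hg.const_mul _).add (hfg.const_mul _)
      rw [integral_add i hf,
        integral_add (hg.const_mul _) (hfg.const_mul _), integral_const_mul, integral_const_mul]
      ring
    rw [e]
    refine integral_nonneg fun x => ?_
    have : t * t * g x ^ 2 + 2 * t * (f x * g x) + f x ^ 2 = (t * g x + f x) ^ 2 := by ring
    simp only [Pi.zero_apply, this]
    positivity
  have := discrim_le_zero h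
  rw [discrim] at this
  nlinarith

theorem measurable_cotTrunc_div (ε : ℝ) :
    Measurable fun p : Circle × Circle => cotTrunc ε (p.1 / p.2) :=
  (measurable_cotTrunc ε).comp (by fun_prop)

theorem hilbertTrunc_eq_integral (μ : Measure Circle) (z : Circle) (ε : ℝ) :
    hilbertTrunc μ z ε = ∫ w, cotTrunc ε (z / w) ∂μ :=
  hilbertTrunc_eq μ z ε

theorem measurable_hilbertTrunc (μ : Measure Circle) [SFinite μ] (ε : ℝ) :
    Measurable fun z => hilbertTrunc μ z ε := by
  simp only [hilbertTrunc_eq_integral]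
  exact (StronglyMeasurable.integral_prod_right
    (f := fun z w => cotTrunc ε (z / w)) (measurable_cotTrunc_div ε).stronglyMeasurable).measurable

/-- The principal values exist everywhere and the truncated integrals are bounded by `C`. -/
structure HilbertBounded (μ : Measure Circle) (C : ℝ) : Prop where
  tendsto : ∀ z, Tendsto (hilbertTrunc μ z) (𝓝[>] 0) (𝓝 (hilbert μ z))
  trunc_le : ∀ ε > 0, ∀ z, |hilbertTrunc μ z ε| ≤ C

theorem HilbertBounded.le {μ : Measure Circle} {C : ℝ} (h : HilbertBounded μ C) (z : Circle) :
    |hilbert μ z| ≤ C :=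
  le_of_tendsto (h.tendsto z).abs (by
    filter_upwards [self_mem_nhdsWithin] with ε hε using h.trunc_le ε hε z)

theorem HilbertBounded.measurable {μ : Measure Circle} [SFinite μ] {C : ℝ}
    (h : HilbertBounded μ C) : Measurable (hilbert μ) :=
  measurable_of_tendsto_metrizable' (𝓝[>] (0 : ℝ)) (fun ε => measurable_hilbertTrunc μ ε)
    (tendsto_pi_nhds.2 h.tendsto)

theorem HilbertBounded.tendsto_integral {μ : Measure Circle} [IsProbabilityMeasure μ] {C : ℝ}
    (hμ : HilbertBounded μ C) {h : Circle → ℝ} (hm : Measurable h) {B : ℝ} (hB : ∀ z, |h z| ≤ B) :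
    Tendsto (fun ε => ∫ z, hilbertTrunc μ z ε * h z ∂μ) (𝓝[>] 0)
      (𝓝 (∫ z, hilbert μ z * h z ∂μ)) := by
  refine tendsto_integral_filter_of_dominated_convergence (fun _ => C * B)
    (Eventually.of_forall fun ε => ((measurable_hilbertTrunc μ ε).mul hm).aestronglyMeasurable)
    ?_ (integrable_const _) (Eventually.of_forall fun z => (hμ.tendsto z).mul_const _)
  filter_upwards [self_mem_nhdsWithin] with ε hε
  refine Eventually.of_forall fun z => ?_
  rw [norm_mul]
  exact mul_le_mul (hμ.trunc_le ε hε z) (hB z) (norm_nonneg _)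
    ((abs_nonneg _).trans (hμ.trunc_le ε hε z))

theorem integrable_cotTrunc_mul (μ : Measure Circle) [IsProbabilityMeasure μ] {ε : ℝ} (hε : 0 < ε)
    {g : Circle × Circle → ℝ} (hm : Measurable g) {B : ℝ} (hB : ∀ z, |g z| ≤ B) :
    Integrable (fun p : Circle × Circle => cotTrunc ε (p.1 / p.2) * g p) (μ.prod μ) :=
  integrable_of_abs_le ((measurable_cotTrunc_div ε).mul hm) (C := 2 / ε * B) fun p => by
    rw [abs_mul]
    exact mul_le_mul (abs_cotTrunc_le hε _) (hB _) (abs_nonneg _) (by positivity)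

/-- Exchanging the variables reverses the sign of the kernel, so both halves of the difference
contribute equally. -/
theorem integral_cotTrunc_mul_sub (μ : Measure Circle) [IsProbabilityMeasure μ] {ε : ℝ}
    (hε : 0 < ε) {h : Circle → ℝ} (hm : Measurable h) {B : ℝ} (hB : ∀ z, |h z| ≤ B) :
    ∫ p : Circle × Circle, cotTrunc ε (p.1 / p.2) * (h p.1 - h p.2) ∂μ.prod μ =
      2 * ∫ z, hilbertTrunc μ z ε * h z ∂μ := by
  have i1 := integrable_cotTrunc_mul μ hε (hm.comp measurable_fst) (fun p => hB p.1)
  have i2 := integrable_cotTrunc_mul μ hε (hm.comp measurable_snd) (fun p => hB p.2)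
  simp only [Function.comp_def] at i1 i2
  have e1 : ∫ p : Circle × Circle, cotTrunc ε (p.1 / p.2) * h p.1 ∂μ.prod μ =
      ∫ z, hilbertTrunc μ z ε * h z ∂μ := by
    rw [integral_prod _ i1]
    simp only [integral_mul_const, hilbertTrunc_eq_integral]
  have e2 : ∫ p : Circle × Circle, cotTrunc ε (p.1 / p.2) * h p.2 ∂μ.prod μ =
      -∫ p : Circle × Circle, cotTrunc ε (p.1 / p.2) * h p.1 ∂μ.prod μ := by
    rw [← integral_prod_swap, ← integral_neg]
    congr 1
    funext p
    rw [Prod.fst_swap, Prod.snd_swap, ← inv_div, cotTrunc_inv, neg_mul]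
  simp only [mul_sub]
  rw [integral_sub i1 i2, e2, e1]
  ring

/-- The symmetrisation identity with a constant test function. -/
theorem HilbertBounded.integral_eq_zero {μ : Measure Circle} [IsProbabilityMeasure μ] {C : ℝ}
    (hμ : HilbertBounded μ C) : ∫ z, hilbert μ z ∂μ = 0 := by
  have hB : ∀ _ : Circle, |(1 : ℝ)| ≤ 1 := fun _ => by simp
  have h := hμ.tendsto_integral (h := fun _ => 1) measurable_const hB
  simp only [mul_one] at h
  refine tendsto_nhds_unique (h.congr' (f₂ := fun _ => 0) ?_) tendsto_const_nhds
  filter_upwards [self_mem_nhdsWithin] with ε hε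
  have := integral_cotTrunc_mul_sub μ hε (h := fun _ => 1) measurable_const hB
  simp only [sub_self, mul_zero, integral_zero, mul_one] at this
  linarith

/-! ### Displacement convexity of the logarithmic energy -/

theorem log_chord_tangent_of_lt {x y x' y' : ℝ} (h : x - y ∈ Ioo 0 (2 * Real.pi))
    (h' : x' - y' ∈ Icc 0 (2 * Real.pi)) (hne : (Circle.exp x' : ℂ) - Circle.exp y' ≠ 0) :
    -(1 / 2) * cotKernel (Circle.exp x / Circle.exp y) * ((x' - x) - (y' - y)) +
      1 / 8 * ((x' - x) - (y' - y)) ^ 2 ≤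
      Real.log ‖(Circle.exp x : ℂ) - Circle.exp y‖ -
        Real.log ‖(Circle.exp x' : ℂ) - Circle.exp y'‖ := by
  -- At either endpoint of the interval the two points of the circle coincide.
  have h'' : x' - y' ∈ Ioo 0 (2 * Real.pi) := by
    rw [← norm_ne_zero_iff, norm_exp_sub_exp] at hne
    refine ⟨h'.1.lt_of_ne' fun h0 => hne (by simp [h0]), h'.2.lt_of_ne fun h0 => hne ?_⟩
    rw [h0, mul_div_cancel_left₀ _ two_ne_zero, Real.sin_pi, abs_zero, mul_zero]
  have key := log_sin_tangent h h''
  have hpos : ∀ t ∈ Ioo 0 (2 * Real.pi), 0 < Real.sin (t / 2) := fun t ht =>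
    Real.sin_pos_of_pos_of_lt_pi (by linarith [ht.1]) (by linarith [ht.2])
  rw [norm_exp_sub_exp, norm_exp_sub_exp, abs_of_pos (hpos _ h), abs_of_pos (hpos _ h''),
    ← Circle.exp_sub, cotKernel_exp]
  convert key using 2 <;> ring

/-- Both sides are symmetric in `z` and `w`, as the kernel is odd, so one may assume `X w < X z`.
Order preservation then keeps the transported difference in `[0, 2π]`. -/
theorem log_chord_tangent {X Y : Circle → ℝ} {u v : ℝ} (hXe : ∀ z, Circle.exp (X z) = z)
    (hX : ∀ z, X z ∈ Ico u (u + 2 * Real.pi)) (hY : ∀ z, Y z ∈ Icc v (v + 2 * Real.pi))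
    (hXY : ∀ z w, X z ≤ X w → Y z ≤ Y w) {z w : Circle} (hzw : z ≠ w)
    (hne : (Circle.exp (Y z) : ℂ) - Circle.exp (Y w) ≠ 0) :
    -(1 / 2) * cotKernel (z / w) * ((Y z - X z) - (Y w - X w)) +
      1 / 8 * ((Y z - X z) - (Y w - X w)) ^ 2 ≤
      Real.log ‖(z : ℂ) - w‖ - Real.log ‖(Circle.exp (Y z) : ℂ) - Circle.exp (Y w)‖ := by
  have main : ∀ z w, X w < X z → (Circle.exp (Y z) : ℂ) - Circle.exp (Y w) ≠ 0 →
      -(1 / 2) * cotKernel (z / w) * ((Y z - X z) - (Y w - X w)) +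
      1 / 8 * ((Y z - X z) - (Y w - X w)) ^ 2 ≤
      Real.log ‖(z : ℂ) - w‖ - Real.log ‖(Circle.exp (Y z) : ℂ) - Circle.exp (Y w)‖ := by
    intro z w hlt hne
    have := log_chord_tangent_of_lt (x := X z) (y := X w)
      ⟨by linarith, by linarith [(hX z).2, (hX w).1]⟩
      ⟨by linarith [hXY w z hlt.le], by linarith [(hY z).2, (hY w).1]⟩ hne
    rwa [hXe, hXe] at this
  rcases lt_trichotomy (X z) (X w) with h | h | h
  · have := main w z h (by rwa [← neg_ne_zero, neg_sub])
    rw [← inv_div z w, cotKernel_inv, norm_sub_rev, norm_sub_rev (Circle.exp (Y w) : ℂ)] at this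
    convert this using 1
    ring
  · exact absurd (by rw [← hXe z, ← hXe w, h]) hzw
  · exact main z w h hne

/-- The cross term is the square of the mean. This is where equality of the means of the lifts
produces the full quadratic gain. -/
theorem integral_sub_sq_prod {μ : Measure Circle} [IsProbabilityMeasure μ] {h : Circle → ℝ}
    (hm : Measurable h) {B : ℝ} (hB : ∀ z, |h z| ≤ B) (h0 : ∫ z, h z ∂μ = 0) :
    ∫ p : Circle × Circle, (h p.1 - h p.2) ^ 2 ∂μ.prod μ = 2 * ∫ z, h z ^ 2 ∂μ := by
  have i2 : Integrable (fun z => h z ^ 2) μ :=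
    integrable_of_abs_le (hm.pow_const 2) (C := B ^ 2) fun z => by
      rw [abs_pow]; exact pow_le_pow_left₀ (abs_nonneg _) (hB z) 2
  have i1 : Integrable h μ := integrable_of_abs_le hm hB
  have e1 : ∫ p : Circle × Circle, h p.1 ^ 2 ∂μ.prod μ = ∫ z, h z ^ 2 ∂μ := by
    simpa using integral_fun_fst (μ := μ) (ν := μ) (fun z => h z ^ 2)
  have e2 : ∫ p : Circle × Circle, h p.2 ^ 2 ∂μ.prod μ = ∫ z, h z ^ 2 ∂μ := by
    simpa using integral_fun_snd (μ := μ) (ν := μ) (fun z => h z ^ 2)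
  have e3 : ∫ p : Circle × Circle, h p.1 * h p.2 ∂μ.prod μ = 0 := by
    rw [integral_prod_mul, h0, zero_mul]
  have e : ∀ p : Circle × Circle,
      (h p.1 - h p.2) ^ 2 = h p.1 ^ 2 + h p.2 ^ 2 - 2 * (h p.1 * h p.2) := fun p => by ring
  simp only [e]
  have i : Integrable (fun p : Circle × Circle => h p.1 ^ 2 + h p.2 ^ 2) (μ.prod μ) :=
    (i2.comp_fst μ).add (i2.comp_snd μ)
  rw [integral_sub i ((i1.mul_prod i1).const_mul 2),
    integral_add (i2.comp_fst μ) (i2.comp_snd μ), integral_const_mul, e1, e2, e3]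
  ring

theorem HilbertBounded.log_energy_displacement {μ : Measure Circle} [IsProbabilityMeasure μ]
    {C : ℝ} (hμ : HilbertBounded μ C) (hμE : negLogEnergy μ ≠ ⊤) {X Y : Circle → ℝ} {u v : ℝ}
    (hXm : Measurable X) (hYm : Measurable Y) (hXe : ∀ z, Circle.exp (X z) = z)
    (hX : ∀ z, X z ∈ Ico u (u + 2 * Real.pi)) (hY : ∀ z, Y z ∈ Icc v (v + 2 * Real.pi))
    (hXY : ∀ z w, X z ≤ X w → Y z ≤ Y w) (hmean : ∫ z, (Y z - X z) ∂μ = 0)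
    (hνE : negLogEnergy (μ.map fun z => Circle.exp (Y z)) ≠ ⊤) :
    -∫ z, hilbert μ z * (Y z - X z) ∂μ + 1 / 4 * ∫ z, (Y z - X z) ^ 2 ∂μ ≤
      ∫ p, Real.log ‖(p.1 : ℂ) - p.2‖ ∂μ.prod μ -
      ∫ p, Real.log ‖(p.1 : ℂ) - p.2‖
        ∂(μ.map fun z => Circle.exp (Y z)).prod (μ.map fun z => Circle.exp (Y z)) := by
  set h : Circle → ℝ := fun z => Y z - X z with hh
  have hm : Measurable h := hYm.sub hXm
  obtain ⟨B, hB⟩ : ∃ B, ∀ z, |h z| ≤ B := ⟨|v| + |u| + 2 * Real.pi, fun z => by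
    have h1 := hX z
    have h2 := hY z
    rw [hh, abs_le]
    constructor <;> simp only <;>
      linarith [h1.1, h1.2, h2.1, h2.2, neg_abs_le u, le_abs_self u, neg_abs_le v, le_abs_self v]⟩
  set S : Circle → Circle := fun z => Circle.exp (Y z) with hS
  have hSm : Measurable S := Circle.exp.continuous.measurable.comp hYm
  have hSSm : Measurable (Prod.map S S) := hSm.prodMap hSm
  have hνP : IsProbabilityMeasure (μ.map S) := Measure.isProbabilityMeasure_map hSm.aemeasurable
  have hprod := Measure.map_prod_map μ μ hSm hSm
  have iμ := integrable_log_norm_sub hμE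
  have iν := integrable_log_norm_sub hνE
  have aeμ := ae_ne_of_negLogEnergy_ne_top hμE
  have aeν := ae_ne_of_negLogEnergy_ne_top hνE
  rw [hprod] at iν aeν
  replace iν := iν.comp_measurable hSSm
  replace aeν := ae_of_ae_map hSSm.aemeasurable aeν
  rw [hprod, integral_map hSSm.aemeasurable measurable_log_norm_sub.aestronglyMeasurable]
  simp only [Function.comp_def, Prod.map_fst, Prod.map_snd] at iν aeν ⊢
  rw [← integral_sub iμ iν]
  -- All terms are cut off on the same neighbourhood of the diagonal. The pointwise inequality
  -- survives, since both sides vanish off `R ε`, and the kernel becomes bounded; then `ε → 0`.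
  let R : ℝ → Set (Circle × Circle) := fun ε => {p | ε < ‖(p.1 : ℂ) - p.2‖}
  have hR : ∀ ε, MeasurableSet (R ε) := fun ε =>
    (isOpen_lt continuous_const (by fun_prop)).measurableSet
  have hRlim : ∀ᵐ p ∂μ.prod μ, ∀ᶠ ε in 𝓝[>] (0 : ℝ), p ∈ R ε := by
    filter_upwards [aeμ] with p hp
    filter_upwards [nhdsWithin_le_nhds (Iio_mem_nhds (norm_pos_iff.2 hp))] with ε hε using hε
  have hlim : ∀ f : Circle × Circle → ℝ, Integrable f (μ.prod μ) →
      Tendsto (fun ε => ∫ p, (R ε).indicator f p ∂μ.prod μ) (𝓝[>] 0) (𝓝 (∫ p, f p ∂μ.prod μ)) := by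
    intro f hf
    refine tendsto_integral_filter_of_dominated_convergence (fun p => ‖f p‖)
      (Eventually.of_forall fun ε => hf.aestronglyMeasurable.indicator (hR ε))
      (Eventually.of_forall fun ε => Eventually.of_forall fun p => norm_indicator_le_norm_self _ _)
      hf.norm ?_
    filter_upwards [hRlim] with p hp
    refine tendsto_const_nhds.congr' ?_
    filter_upwards [hp] with ε hε
    rw [indicator_of_mem hε]
  have isq : Integrable (fun p : Circle × Circle => (h p.1 - h p.2) ^ 2) (μ.prod μ) :=
    integrable_of_abs_le (by fun_prop) (C := (B + B) ^ 2) fun p => by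
      rw [abs_pow]
      exact pow_le_pow_left₀ (abs_nonneg _)
        ((abs_sub _ _).trans (add_le_add (hB p.1) (hB p.2))) 2
  have L1 := ((hμ.tendsto_integral hm hB).neg).add ((hlim _ isq).const_mul (1 / 8))
  rw [integral_sub_sq_prod hm hB hmean] at L1
  have L2 := hlim _ (iμ.sub iν)
  rw [show ∀ a : ℝ, 1 / 4 * a = 1 / 8 * (2 * a) from fun a => by ring]
  refine le_of_tendsto_of_tendsto L1 L2 ?_
  filter_upwards [self_mem_nhdsWithin] with ε hε
  have hsub : ∀ p : Circle × Circle, |h p.1 - h p.2| ≤ B + B := fun p =>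
    (abs_sub _ _).trans (add_le_add (hB p.1) (hB p.2))
  have i1 := (integrable_cotTrunc_mul μ hε (g := fun p => h p.1 - h p.2) (by fun_prop)
    hsub).const_mul (-(1 / 2))
  have i2 := (isq.indicator (hR ε)).const_mul (1 / 8)
  have e : -∫ z, hilbertTrunc μ z ε * h z ∂μ =
      ∫ p : Circle × Circle, -(1 / 2) * (cotTrunc ε (p.1 / p.2) * (h p.1 - h p.2)) ∂μ.prod μ := by
    rw [integral_const_mul, integral_cotTrunc_mul_sub μ hε hm hB]
    ring
  rw [e, ← integral_const_mul, ← integral_add i1 i2]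
  refine integral_mono_ae (i1.add i2) ((iμ.sub iν).indicator (hR ε)) ?_
  filter_upwards [aeμ, aeν] with p hp hp'
  by_cases hpR : p ∈ R ε
  · have hc : cotTrunc ε (p.1 / p.2) = cotKernel (p.1 / p.2) :=
      indicator_of_mem (by
        rw [mem_ofPred_eq, ← norm_sub_eq_norm_div_sub_one]; exact hpR) _
    have key := log_chord_tangent hXe hX hY hXY (z := p.1) (w := p.2)
      (fun h0 => hp (by rw [h0, sub_self])) hp'
    simp only [indicator_of_mem hpR, hc, Pi.sub_apply]
    rw [← mul_assoc]
    exact key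
  · have hc : cotTrunc ε (p.1 / p.2) = 0 :=
      indicator_of_notMem (by
        rw [mem_ofPred_eq, ← norm_sub_eq_norm_div_sub_one]; exact hpR) _
    simp only [indicator_of_notMem hpR, hc]
    simp

/-! ### The inequality for one pair of lifts -/

theorem IsCn.second_order_lower_bound {Q : Circle → ℝ} (hQ : IsCn 2 Q) {c : ℝ}
    (hc : ∀ z, c ≤ circleDeriv (circleDeriv Q) z) (x y : ℝ) :
    Q (Circle.exp x) + circleDeriv Q (Circle.exp x) * (y - x) + c / 2 * (y - x) ^ 2 ≤
      Q (Circle.exp y) := by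
  have hd : ContDiff ℝ 1 (deriv fun x : ℝ => Q (Circle.exp x)) :=
    ContDiff.deriv' (n := 1) hQ
  have e : (fun x : ℝ => circleDeriv Q (Circle.exp x)) = deriv fun x : ℝ => Q (Circle.exp x) :=
    funext (circleDeriv_exp Q)
  refine FreeCircle.second_order_lower_bound (s := univ) convex_univ isOpen_univ
    (f := fun x => Q (Circle.exp x)) (f' := fun x => circleDeriv Q (Circle.exp x))
    (f'' := fun x => circleDeriv (circleDeriv Q) (Circle.exp x)) (fun x _ => ?_) (fun x _ => ?_)
    (fun x _ => hc _) (mem_univ x) (mem_univ y)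
  · rw [circleDeriv_exp]
    exact ((ContDiff.differentiable hQ two_ne_zero) x).hasDerivAt
  · rw [circleDeriv_exp, e]
    exact ((hd.differentiable one_ne_zero) x).hasDerivAt

/-- The second-order coefficients combine as `(ρ - 1/2)/2` from the potential and `1/4` from the
logarithm, giving `ρ/2`. -/
theorem HilbertBounded.energy_displacement {Q : Circle → ℝ} (hQ : IsCn 2 Q) {ρ : ℝ}
    (hconv : ∀ z, ρ - 1 / 2 ≤ circleDeriv (circleDeriv Q) z)
    {μ ν : Measure Circle} [IsProbabilityMeasure μ] [IsProbabilityMeasure ν]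
    {C : ℝ} (hμ : HilbertBounded μ C) (hμE : negLogEnergy μ ≠ ⊤) (hνE : negLogEnergy ν ≠ ⊤)
    {X Y : Circle → ℝ} {u v : ℝ}
    (hXm : Measurable X) (hYm : Measurable Y) (hXe : ∀ z, Circle.exp (X z) = z)
    (hX : ∀ z, X z ∈ Ico u (u + 2 * Real.pi)) (hY : ∀ z, Y z ∈ Icc v (v + 2 * Real.pi))
    (hXY : ∀ z w, X z ≤ X w → Y z ≤ Y w) (hmean : ∫ z, (Y z - X z) ∂μ = 0)
    (hν : μ.map (fun z => Circle.exp (Y z)) = ν) :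
    energy Q μ - energy Q ν ≤ ((∫ z, (hilbert μ z - circleDeriv Q z) * (Y z - X z) ∂μ -
      ρ / 2 * ∫ z, (Y z - X z) ^ 2 ∂μ : ℝ) : EReal) := by
  have hQc : Continuous fun x : ℝ => Q (Circle.exp x) := ContDiff.continuous hQ
  have hQm := measurable_of_continuous_exp hQc
  obtain ⟨K, -, hK⟩ := exists_abs_le_of_continuous_exp hQc
  have hQ'c := continuous_circleDeriv_exp (ContDiff.of_le hQ one_le_two)
  have hQ'm := measurable_of_continuous_exp hQ'c
  obtain ⟨K', hK'0, hK'⟩ := exists_abs_le_of_continuous_exp hQ'c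
  have hm : Measurable fun z => Y z - X z := hYm.sub hXm
  obtain ⟨B, hB⟩ : ∃ B, ∀ z, |Y z - X z| ≤ B := ⟨|v| + |u| + 2 * Real.pi, fun z => by
    have h1 := hX z
    have h2 := hY z
    rw [abs_le]
    constructor <;>
      linarith [h1.1, h1.2, h2.1, h2.2, neg_abs_le u, le_abs_self u, neg_abs_le v, le_abs_self v]⟩
  have hSm : Measurable fun z => Circle.exp (Y z) := Circle.exp.continuous.measurable.comp hYm
  have hlog := hμ.log_energy_displacement hμE hXm hYm hXe hX hY hXY hmean (hν.symm ▸ hνE)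
  rw [hν] at hlog
  rw [energy_eq_coe Q hμE, energy_eq_coe Q hνE, ← EReal.coe_sub, EReal.coe_le_coe_iff]
  have iQ' : Integrable (fun z => circleDeriv Q z * (Y z - X z)) μ :=
    integrable_of_abs_le (hQ'm.mul hm) (C := K' * B) fun z => by
      rw [abs_mul]; exact mul_le_mul (hK' z) (hB z) (abs_nonneg _) hK'0
  have iH : Integrable (fun z => hilbert μ z * (Y z - X z)) μ :=
    integrable_of_abs_le (hμ.measurable.mul hm) (C := C * B) fun z => by
      rw [abs_mul]
      exact mul_le_mul (hμ.le z) (hB z) (abs_nonneg _) ((abs_nonneg _).trans (hμ.le z))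
  have isq : Integrable (fun z => (Y z - X z) ^ 2) μ :=
    integrable_of_abs_le (hm.pow_const 2) (C := B ^ 2) fun z => by
      rw [abs_pow]; exact pow_le_pow_left₀ (abs_nonneg _) (hB z) 2
  have iQ : Integrable Q μ := integrable_of_abs_le hQm hK
  have iQS : Integrable (fun z => Q (Circle.exp (Y z))) μ :=
    integrable_of_abs_le (hQm.comp hSm) fun z => hK _
  have hpot : ∫ z, circleDeriv Q z * (Y z - X z) ∂μ +
      (ρ - 1 / 2) / 2 * ∫ z, (Y z - X z) ^ 2 ∂μ ≤ ∫ z, Q z ∂ν - ∫ z, Q z ∂μ := by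
    rw [← hν, integral_map hSm.aemeasurable hQm.aestronglyMeasurable, ← integral_sub iQS iQ,
      ← integral_const_mul, ← integral_add iQ' (isq.const_mul _)]
    refine integral_mono (iQ'.add (isq.const_mul _)) (iQS.sub iQ) fun z => ?_
    have := hQ.second_order_lower_bound hconv (X z) (Y z)
    rw [hXe] at this
    dsimp only
    linarith
  simp only [sub_mul (hilbert _ _)]
  rw [integral_sub iH iQ']
  linarith

theorem HilbertBounded.integrable_sq_sub {μ : Measure Circle} [IsProbabilityMeasure μ]
    {C : ℝ} (hμ : HilbertBounded μ C) {g : Circle → ℝ} (hg : Measurable g) {K : ℝ}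
    (hK : ∀ z, |g z| ≤ K) : Integrable (fun z => (hilbert μ z - g z) ^ 2) μ :=
  integrable_of_abs_le ((hμ.measurable.sub hg).pow_const 2) (C := (C + K) ^ 2) fun z => by
    rw [abs_pow]
    exact pow_le_pow_left₀ (abs_nonneg _)
      ((abs_sub _ _).trans (add_le_add (hμ.le z) (hK z))) 2

/-- The free Fisher information is the variance of `Hμ - Q'`. -/
theorem HilbertBounded.fisherInfo_eq {Q : Circle → ℝ} (hQ : IsCn 1 Q) {μ : Measure Circle}
    [IsProbabilityMeasure μ] {C : ℝ} (hμ : HilbertBounded μ C) :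
    fisherInfo Q μ =
      ∫ z, (hilbert μ z - circleDeriv Q z + ∫ w, circleDeriv Q w ∂μ) ^ 2 ∂μ := by
  have hQ'c := continuous_circleDeriv_exp hQ
  have hQ'm := measurable_of_continuous_exp hQ'c
  obtain ⟨K', -, hK'⟩ := exists_abs_le_of_continuous_exp hQ'c
  have iH : Integrable (hilbert μ) μ := integrable_of_abs_le hμ.measurable hμ.le
  have iQ' : Integrable (circleDeriv Q) μ := integrable_of_abs_le hQ'm hK'
  have i2 := hμ.integrable_sq_sub hQ'm hK'
  set c := ∫ w, circleDeriv Q w ∂μ with hc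
  have e : ∀ z, (hilbert μ z - circleDeriv Q z + c) ^ 2 =
      (hilbert μ z - circleDeriv Q z) ^ 2 + (2 * c * (hilbert μ z - circleDeriv Q z) + c ^ 2) :=
    fun z => by ring
  have i3 : Integrable (fun z => 2 * c * (hilbert μ z - circleDeriv Q z)) μ :=
    (iH.sub iQ').const_mul _
  have i4 : Integrable (fun z => 2 * c * (hilbert μ z - circleDeriv Q z) + c ^ 2) μ :=
    i3.add (integrable_const _)
  simp only [e]
  rw [integral_add i2 i4, integral_add i3 (integrable_const _),
    integral_const_mul, integral_sub iH iQ', hμ.integral_eq_zero, ← hc, fisherInfo, ← hc]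
  simp
  ring

theorem HilbertBounded.hwi_of_sameMean {Q : Circle → ℝ} (hQ : IsCn 2 Q) {ρ : ℝ}
    (hconv : ∀ z, ρ - 1 / 2 ≤ circleDeriv (circleDeriv Q) z)
    {μ ν : Measure Circle} [IsProbabilityMeasure μ] [NullSingletonClass μ]
    [IsProbabilityMeasure ν] {C : ℝ} (hμ : HilbertBounded μ C) (hμE : negLogEnergy μ ≠ ⊤)
    (hνE : negLogEnergy ν ≠ ⊤) {u v : ℝ} (h : SameMean μ ν u v) :
    ∃ w : ℝ, 0 ≤ w ∧ w ≤ 4 * Real.pi ∧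
      wasserstein 2 (lift μ u) (lift ν v) = ENNReal.ofReal w ∧
      energy Q μ - energy Q ν ≤ ((√(fisherInfo Q μ) * w - ρ / 2 * w ^ 2 : ℝ) : EReal) := by
  have hXm := measurable_liftAngle u
  have hm : IsProbabilityMeasure (lift μ u) := Measure.isProbabilityMeasure_map hXm.aemeasurable
  have hn : IsProbabilityMeasure (lift ν v) :=
    Measure.isProbabilityMeasure_map (measurable_liftAngle v).aemeasurable
  have hms : NullSingletonClass (lift μ u) := ⟨fun x => by
    rw [lift, Measure.map_apply hXm (measurableSet_singleton x)]
    refine measure_mono_null (fun z hz => ?_) (measure_singleton (μ := μ) (Circle.exp x))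
    rw [mem_singleton_iff, ← exp_liftAngle u z]
    exact congrArg _ hz⟩
  have hmI : ∀ᵐ x ∂lift μ u, x ∈ Icc u (u + 2 * Real.pi) :=
    (ae_map_iff hXm.aemeasurable measurableSet_Icc).2
      (Eventually.of_forall fun z => Ico_subset_Icc_self (liftAngle_mem u z))
  have hnI : ∀ᵐ x ∂lift ν v, x ∈ Icc v (v + 2 * Real.pi) :=
    (ae_map_iff (measurable_liftAngle v).aemeasurable measurableSet_Icc).2
      (Eventually.of_forall fun z => Ico_subset_Icc_self (liftAngle_mem v z))
  obtain ⟨T, hT, hTI, hTmap⟩ := exists_monotone_transport (lift μ u) (lift ν v)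
    (by linarith [Real.pi_pos]) hnI
  have hTm := hT.measurable
  have hYm : Measurable fun z => T (liftAngle u z) := hTm.comp hXm
  have hW : wasserstein 2 (lift μ u) (lift ν v) =
      ENNReal.ofReal (√(∫ z, (T (liftAngle u z) - liftAngle u z) ^ 2 ∂μ)) := by
    have hsq : Measurable fun x => (x - T x) ^ 2 := (measurable_id.sub hTm).pow_const 2
    rw [← hTmap, wasserstein_two_eq hT hmI hTI, lift,
      integral_map hXm.aemeasurable hsq.aestronglyMeasurable]
    simp only [sub_sq_comm]
  have hYmap : μ.map (fun z => T (liftAngle u z)) = lift ν v := by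
    rw [← hTmap, lift, Measure.map_map hTm hXm]
    rfl
  have hν : μ.map (fun z => Circle.exp (T (liftAngle u z))) = ν := by
    have h1 := Measure.map_map (μ := μ) Circle.exp.continuous.measurable hYm
    rw [hYmap, lift, Measure.map_map Circle.exp.continuous.measurable
      (measurable_liftAngle v)] at h1
    rw [← show (Circle.exp ∘ fun z => T (liftAngle u z)) =
      fun z => Circle.exp (T (liftAngle u z)) from rfl, ← h1]
    have : Circle.exp ∘ liftAngle v = id := funext fun z => exp_liftAngle v z
    rw [this, Measure.map_id]
  have hYle : ∀ z, |T (liftAngle u z)| ≤ |v| + 2 * Real.pi := fun z => by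
    have := hTI (liftAngle u z)
    rw [abs_le]
    constructor <;> linarith [this.1, this.2, neg_abs_le v, le_abs_self v, Real.pi_pos]
  have hmean : ∫ z, (T (liftAngle u z) - liftAngle u z) ∂μ = 0 := by
    rw [integral_sub (integrable_of_abs_le hYm hYle) (integrable_liftAngle μ u),
      ← integral_id_lift, h.2.2, ← hYmap, integral_map hYm.aemeasurable (by fun_prop), sub_self]
  -- Both angles lie in `[0, 4π]` because `u` and `v` lie in `[0, 2π]`.
  have hB : ∀ z, |T (liftAngle u z) - liftAngle u z| ≤ 4 * Real.pi := fun z => by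
    have h1 := hTI (liftAngle u z)
    have h2 := liftAngle_mem u z
    obtain ⟨hu, hv, -⟩ := h
    rw [abs_le]
    constructor <;> linarith [h1.1, h1.2, h2.1, h2.2, hu.1, hu.2, hv.1, hv.2]
  have hm' : Measurable fun z => T (liftAngle u z) - liftAngle u z := hYm.sub hXm
  have isq : Integrable (fun z => (T (liftAngle u z) - liftAngle u z) ^ 2) μ :=
    integrable_of_abs_le (hm'.pow_const 2) (C := (4 * Real.pi) ^ 2) fun z => by
      rw [abs_pow]; exact pow_le_pow_left₀ (abs_nonneg _) (hB z) 2
  refine ⟨_, Real.sqrt_nonneg _, ?_, hW, ?_⟩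
  · refine Real.sqrt_le_iff.2 ⟨by positivity, ?_⟩
    have := integral_mono isq (integrable_const ((4 * Real.pi) ^ 2)) fun z => by
      simpa using sq_le_sq' (abs_le.1 (hB z)).1 (abs_le.1 (hB z)).2
    simpa using this
  refine (hμ.energy_displacement hQ hconv hμE hνE hXm hYm (exp_liftAngle u) (liftAngle_mem u)
    (fun z => hTI _) (fun z w hzw => hT hzw) hmean hν).trans ?_
  rw [EReal.coe_le_coe_iff, Real.sq_sqrt (integral_nonneg fun z => sq_nonneg _)]
  refine sub_le_sub_right ?_ _
  have hQ1 : IsCn 1 Q := ContDiff.of_le hQ one_le_two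
  have hQ'c := continuous_circleDeriv_exp hQ1
  have hQ'm := measurable_of_continuous_exp hQ'c
  obtain ⟨K', hK'0, hK'⟩ := exists_abs_le_of_continuous_exp hQ'c
  set c := ∫ w, circleDeriv Q w ∂μ with hc
  have hgm : Measurable fun z => circleDeriv Q z - c := hQ'm.sub_const c
  have hgb : ∀ z, |circleDeriv Q z - c| ≤ K' + |c| := fun z =>
    (abs_sub _ _).trans (add_le_add (hK' z) le_rfl)
  have isqF : Integrable (fun z => (hilbert μ z - circleDeriv Q z + c) ^ 2) μ := by
    simpa only [sub_sub_eq_add_sub, sub_add_eq_add_sub] using hμ.integrable_sq_sub hgm hgb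
  have hFm : Measurable fun z => hilbert μ z - circleDeriv Q z :=
    hμ.measurable.sub hQ'm
  have hFb : ∀ z, |hilbert μ z - circleDeriv Q z| ≤ C + K' := fun z =>
    (abs_sub _ _).trans (add_le_add (hμ.le z) (hK' z))
  have iFh : Integrable (fun z => (hilbert μ z - circleDeriv Q z) *
      (T (liftAngle u z) - liftAngle u z)) μ :=
    integrable_of_abs_le (hFm.mul hm') (C := (C + K') * (4 * Real.pi)) fun z => by
      rw [abs_mul]
      exact mul_le_mul (hFb z) (hB z) (abs_nonneg _) ((abs_nonneg _).trans (hFb z))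
  have ih : Integrable (fun z => c * (T (liftAngle u z) - liftAngle u z)) μ :=
    (integrable_of_abs_le hm' hB).const_mul c
  -- The displacement has mean zero, so centring `Hμ - Q'` is free; it replaces the second moment by
  -- the variance in Cauchy–Schwarz.
  have e : ∫ z, (hilbert μ z - circleDeriv Q z) * (T (liftAngle u z) - liftAngle u z) ∂μ =
      ∫ z, (hilbert μ z - circleDeriv Q z + c) * (T (liftAngle u z) - liftAngle u z) ∂μ := by
    simp only [add_mul]
    rw [integral_add iFh ih, integral_const_mul, hmean, mul_zero, add_zero]
  have iFch : Integrable (fun z => (hilbert μ z - circleDeriv Q z + c) *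
      (T (liftAngle u z) - liftAngle u z)) μ := by
    simp only [add_mul]
    exact iFh.add ih
  rw [e, hμ.fisherInfo_eq hQ1, ← Real.sqrt_mul (integral_nonneg fun z => sq_nonneg _)]
  exact Real.le_sqrt_of_sq_le (sq_integral_mul_le isqF isq iFch)

/-! ### Passage to the supremum over base points -/

theorem modWasserstein_eq_iSup {p : ℝ} {μ ν : Measure Circle} (h : ∃ u v, SameMean μ ν u v) :
    modWasserstein p μ ν =
      ⨆ (u : ℝ) (v : ℝ) (_ : SameMean μ ν u v), wasserstein p (lift μ u) (lift ν v) :=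
  if_pos h

/-- A closed condition satisfied by all the `W_p(μ̄_u, ν̄_v)` with equal means is satisfied by
their supremum. -/
theorem modWasserstein_toReal_mem {p : ℝ} {μ ν : Measure Circle} (h : ∃ u v, SameMean μ ν u v)
    {K : ℝ} {F : Set ℝ} (hF : IsClosed F)
    (hw : ∀ u v, SameMean μ ν u v → ∃ w : ℝ, 0 ≤ w ∧ w ≤ K ∧
      wasserstein p (lift μ u) (lift ν v) = ENNReal.ofReal w ∧ w ∈ F) :
    modWasserstein p μ ν ≠ ⊤ ∧ (modWasserstein p μ ν).toReal ∈ F := by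
  let S : Set ℝ := {w | 0 ≤ w ∧ w ≤ K ∧ w ∈ F ∧ ∃ u v, SameMean μ ν u v ∧
    wasserstein p (lift μ u) (lift ν v) = ENNReal.ofReal w}
  have hSF : S ⊆ F := fun w hw => hw.2.2.1
  have hSb : BddAbove S := ⟨K, fun w hw => hw.2.1⟩
  have hSne : S.Nonempty := by
    obtain ⟨u, v, huv⟩ := h
    obtain ⟨w, h0, hK, he, hmem⟩ := hw u v huv
    exact ⟨w, h0, hK, hmem, u, v, huv, he⟩
  have h0 : 0 ≤ sSup S := Real.sSup_nonneg fun w hw => hw.1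
  have e : modWasserstein p μ ν = ENNReal.ofReal (sSup S) := by
    rw [modWasserstein_eq_iSup h]
    refine le_antisymm (iSup_le fun u => iSup_le fun v => iSup_le fun huv => ?_) ?_
    · obtain ⟨w, h0, hK, he, hmem⟩ := hw u v huv
      rw [he]
      exact ENNReal.ofReal_le_ofReal (le_csSup hSb ⟨h0, hK, hmem, u, v, huv, he⟩)
    · refine ENNReal.ofReal_le_of_le_toReal ?_
      have hle : ∀ w ∈ S, ENNReal.ofReal w ≤
          ⨆ (u : ℝ) (v : ℝ) (_ : SameMean μ ν u v), wasserstein p (lift μ u) (lift ν v) := by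
        rintro w ⟨-, -, -, u, v, huv, he⟩
        rw [← he]
        exact le_iSup_of_le u (le_iSup_of_le v (le_iSup_of_le huv le_rfl))
      have htop : (⨆ (u : ℝ) (v : ℝ) (_ : SameMean μ ν u v),
          wasserstein p (lift μ u) (lift ν v)) ≠ ⊤ := by
        refine ne_top_of_le_ne_top (ENNReal.ofReal_ne_top (r := K))
          (iSup_le fun u => iSup_le fun v => iSup_le fun huv => ?_)
        obtain ⟨w, h0, hK, he, -⟩ := hw u v huv
        rw [he]
        exact ENNReal.ofReal_le_ofReal hK
      exact csSup_le hSne fun w hw => (ENNReal.ofReal_le_iff_le_toReal htop).1 (hle w hw)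
  rw [e, ENNReal.toReal_ofReal h0]
  exact ⟨ENNReal.ofReal_ne_top, hF.closure_subset_iff.2 hSF (csSup_mem_closure hSne hSb)⟩

theorem IsSmoothMeasure.hilbertBounded {μ : Measure Circle} (h : IsSmoothMeasure μ) :
    ∃ C, HilbertBounded μ C := by
  obtain ⟨φ, hφ, h0, rfl⟩ := h
  have hφ1 : IsCn 1 φ := ContDiff.of_le hφ (by exact_mod_cast le_top)
  obtain ⟨C, hC⟩ := hφ1.exists_abs_hilbertTrunc_le h0
  exact ⟨C, fun z => tendsto_nhds_limUnder (hφ1.tendsto_hilbertTrunc h0 z), hC⟩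

theorem IsSmoothMeasure.negLogEnergy_ne_top {μ : Measure Circle} (h : IsSmoothMeasure μ)
    [IsProbabilityMeasure μ] : negLogEnergy μ ≠ ⊤ := by
  obtain ⟨φ, hφ, h0, rfl⟩ := h
  have hc : Continuous fun x : ℝ => φ (Circle.exp x) := ContDiff.continuous hφ
  obtain ⟨M, -, hM⟩ := exists_abs_le_of_continuous_exp hc
  exact negLogEnergy_withDensity_ne_top (measurable_of_continuous_exp hc)
    fun z => (le_abs_self _).trans (hM z)

theorem IsSmoothMeasure.nullSingletonClass {μ : Measure Circle} (h : IsSmoothMeasure μ) :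
    NullSingletonClass μ := by
  obtain ⟨φ, hφ, h0, rfl⟩ := h
  exact ⟨fun x => withDensity_absolutelyContinuous _ _ (measure_singleton x)⟩

/-- The free HWI inequality on the circle. -/
theorem freeHWI_of_deriv2_ge {Q : Circle → ℝ} (hQ : IsCn 2 Q) {ρ : ℝ}
    (hconv : ∀ z, ρ - 1 / 2 ≤ circleDeriv (circleDeriv Q) z) : FreeHWI Q (ρ / 2) := by
  intro μ hμp hμ ν hν
  have hνp := hν.1
  obtain ⟨C, hC⟩ := hμ.hilbertBounded
  have hμE := hμ.negLogEnergy_ne_top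
  have hμT := energy_ne_top Q hμE
  -- Minimality of `ν` serves only to give it finite energy, by comparison with `μ`.
  have hνT : energy Q ν ≠ ⊤ := ne_top_of_le_ne_top hμT (hν.2 μ hμp)
  have hνE := negLogEnergy_ne_top_of_energy_ne_top hνT
  have := hμ.nullSingletonClass
  have hQ1 : IsCn 1 Q := ContDiff.of_le hQ one_le_two
  have hQ'c := continuous_circleDeriv_exp hQ1
  obtain ⟨K, -, hK⟩ := exists_abs_le_of_continuous_exp hQ'c
  -- The bound need not be monotone in `w`, so it is carried to the supremum by closedness.
  have hclosed : IsClosed {w : ℝ | energy Q μ - energy Q ν ≤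
      ((√(fisherInfo Q μ) * w - ρ / 2 * w ^ 2 : ℝ) : EReal)} :=
    isClosed_le continuous_const (continuous_coe_real_ereal.comp (by fun_prop))
  obtain ⟨hfin, hle⟩ := modWasserstein_toReal_mem (exists_sameMean μ ν) hclosed
    fun u v huv => hC.hwi_of_sameMean hQ hconv hμE hνE huv
  refine ⟨⟨hC.tendsto, hC.integrable_sq_sub (measurable_of_continuous_exp hQ'c) hK, ?_, hμT, hνT,
    hfin⟩, hle⟩
  rw [hC.fisherInfo_eq hQ1]
  exact integral_nonneg fun z => sq_nonneg _

end

end FreeCircle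

theorem mainTheorem4 (Q : Circle → ℝ) (hQ : FreeCircle.IsCn 3 Q) (ρ : ℝ)
    (hconv : ∀ z : Circle,
      ρ - 1 / 2 ≤ FreeCircle.circleDeriv (FreeCircle.circleDeriv Q) z) :
    FreeCircle.FreeHWI Q (ρ / 2) :=
  FreeCircle.freeHWI_of_deriv2_ge (ContDiff.of_le hQ (by norm_num)) hconv
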